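/- Let $k$ be a field and let $D$ be a finite-dimensional division algebra over $k$. For a finite-dimensional $k$-algebra $A$, the dual $A^*=\mathrm{Hom}_k(A,k)$ is a coalgebra whose comultiplication is dual to the multiplication of $A$. If $M$ is a finite-dimensional $A$-bimodule (with $k$ acting centrally), then $M^*$ is an $A^*$-bicomodule whose left coaction $M^*\to A^*\otimes M^*$ and right coaction $M^*\to M^*\otimes A^*$ are dual to the actions $A\otimes M\to M$ and $M\otimes A\to M$. For a coalgebra $C$ and a $C$-bicomodule $P$ with coactions $\rho^l,\rho^r$, the cotensor coalgebra is $T_C(P)=C\oplus\bigoplus_{n\ge 1}P^{\Box_C n}$, where $P^{\Box_C n}=P\Box_C\cdots\Box_C P$ ($n$ factors). Its comultiplication is $\Delta_C$ on $C$, is $\rho^l+\rho^r$ on $P$, and for $n\geq 2$ is given by $$\Delta(p_1\Box\cdots\Box p_n)=\sum (p_1)_{-1}\otimes\big((p_1)_0\Box\cdots\Box p_n\big)+\sum_{i=1}^{n-1}(p_1\Box\cdots\Box p_i)\otimes(p_{i+1}\Box\cdots\Box p_n)+\sum\big(p_1\Box\cdots\Box (p_n)_0\big)\otimes (p_n)_1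 .$$ Its counit is $\varepsilon_C$ on $C$ and $0$ on the other summands. A right coideal of a coalgebra $C$ is a subspace $N$ with $\Delta(N)\subseteq N\otimes C$. A coalgebra $C$ is a chain coalgebra if its right coideals are linearly ordered by inclusion. It is a chain coalgebra of type $D$ if, moreover, $(C_0)^*\cong D$ as $k$-algebras, where $C_0$ is the coradical of $C$ (the sum of the simple right coideals, which is a subcoalgebra) and $(C_0)^*$ carries the convolution product $(f*g)(x)=\sum f(x_1)g(x_2)$. Theorem. (1) For every $D$-bimodule $M$ (with $k$ acting centrally) such that $M\cong D$ as $k$-vector spaces, the cotensor coalgebra $T_{D^*}(M^*)$ is a chain coalgebra of type $D$. (2) If $D$ is separable over $k$ (that is, the multiplication map $D\otimes_k D\to D$ is split as a map of $D$-bimodules), then for every chain coalgebra $C$ of type $D$ there are a $D$-bimodule $M$ (with $k$ acting centrally) such that $M\cong D$ as $k$-vector spaces and an injective coalgebra homomorphism $C\to T_{D^*}(M^*)$. -/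

import Mathlib

open scoped TensorProduct DirectSum

noncomputable section

namespace ChainCoalg

open TensorProduct LinearMap

section Factor

section

variable {k : Type*} [Field k] {A B Z : Type*} [AddCommMonoid A] [Module k A] [AddCommMonoid B]
  [Module k B] [AddCommMonoid Z] [Module k Z]

/-- The factorization of a linear map through an injective one whose range contains its range. -/
def factor (j : A →ₗ[k] B) (hj : Function.Injective j) (f : Z →ₗ[k] B)
    (h : ∀ z, f z ∈ range j) : Z →ₗ[k] A :=
  (LinearEquiv.ofInjective j hj).symm.toLinearMap ∘ₗ f.codRestrict (range j) h

theorem factor_apply (j : A →ₗ[k] B) (hj : Function.Injective j) (f : Z →ₗ[k] B)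
    (h : ∀ z, f z ∈ range j) (z : Z) : j (factor j hj f h z) = f z := by
  have := LinearEquiv.apply_symm_apply (LinearEquiv.ofInjective j hj) (f.codRestrict (range j) h z)
  exact congrArg Subtype.val this

end

variable {k : Type*} [Field k]
variable {A B Z V X Y : Type*} [AddCommGroup A] [Module k A] [AddCommGroup B] [Module k B]
  [AddCommGroup Z] [Module k Z] [AddCommGroup V] [Module k V] [AddCommGroup X] [Module k X]
  [AddCommGroup Y] [Module k Y]

theorem lTensor_subtype_injective (V : Type*) [AddCommGroup V] [Module k V] (p : Submodule k X) :
    Function.Injective (p.subtype.lTensor V) :=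
  Module.Flat.lTensor_preserves_injective_linearMap _ p.injective_subtype

theorem rTensor_subtype_injective (V : Type*) [AddCommGroup V] [Module k V] (p : Submodule k X) :
    Function.Injective (p.subtype.rTensor V) :=
  Module.Flat.rTensor_preserves_injective_linearMap _ p.injective_subtype

theorem mem_range_lTensor (f g : X →ₗ[k] Y) (z : V ⊗[k] X)
    (h : f.lTensor V z = g.lTensor V z) :
    z ∈ range ((eqLocus f g).subtype.lTensor V) := by
  have h2 : z ∈ eqLocus (AlgebraTensorModule.lTensor k V f) (AlgebraTensorModule.lTensor k V g) := h
  rw [Module.Flat.eqLocus_lTensor_eq] at h2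
  exact h2

theorem comm_rTensor (f : X →ₗ[k] Y) (z : X ⊗[k] V) :
    TensorProduct.comm k Y V (f.rTensor V z) = f.lTensor V (TensorProduct.comm k X V z) := by
  induction z with
  | zero => simp
  | add x y hx hy => simp only [map_add, hx, hy]
  | tmul x y => simp

theorem mem_range_rTensor (f g : X →ₗ[k] Y) (z : X ⊗[k] V)
    (h : f.rTensor V z = g.rTensor V z) :
    z ∈ range ((eqLocus f g).subtype.rTensor V) := by
  have h2 : f.lTensor V (TensorProduct.comm k X V z) =
      g.lTensor V (TensorProduct.comm k X V z) := by
    rw [← comm_rTensor, ← comm_rTensor, h]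
  obtain ⟨y, hy⟩ := mem_range_lTensor f g _ h2
  refine ⟨(TensorProduct.comm k _ _).symm y, ?_⟩
  apply (TensorProduct.comm k X V).injective
  rw [← hy, comm_rTensor, LinearEquiv.apply_symm_apply]

variable {E W : Type*} [AddCommGroup E] [Module k E] [AddCommGroup W] [Module k W]

theorem nat1 (h : E →ₗ[k] W) (z : (A ⊗[k] B) ⊗[k] E) :
    (h.lTensor B).lTensor A (TensorProduct.assoc k A B E z) =
      TensorProduct.assoc k A B W (h.lTensor (A ⊗[k] B) z) := by
  have : (h.lTensor B).lTensor A ∘ₗ (TensorProduct.assoc k A B E).toLinearMap =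
      (TensorProduct.assoc k A B W).toLinearMap ∘ₗ (h.lTensor (A ⊗[k] B)) := by
    ext; simp
  exact LinearMap.congr_fun this z

theorem nat2 (h : B →ₗ[k] W) (z : (A ⊗[k] B) ⊗[k] E) :
    (h.rTensor E).lTensor A (TensorProduct.assoc k A B E z) =
      TensorProduct.assoc k A W E ((h.lTensor A).rTensor E z) := by
  have : (h.rTensor E).lTensor A ∘ₗ (TensorProduct.assoc k A B E).toLinearMap =
      (TensorProduct.assoc k A W E).toLinearMap ∘ₗ ((h.lTensor A).rTensor E) := by
    ext; simp
  exact LinearMap.congr_fun this z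

theorem nat3 (h : A →ₗ[k] W) (z : (A ⊗[k] B) ⊗[k] E) :
    h.rTensor (B ⊗[k] E) (TensorProduct.assoc k A B E z) =
      TensorProduct.assoc k W B E ((h.rTensor B).rTensor E z) := by
  have : h.rTensor (B ⊗[k] E) ∘ₗ (TensorProduct.assoc k A B E).toLinearMap =
      (TensorProduct.assoc k W B E).toLinearMap ∘ₗ ((h.rTensor B).rTensor E) := by
    ext; simp
  exact LinearMap.congr_fun this z

theorem interchange (f : A →ₗ[k] B) (g : E →ₗ[k] W) (z : A ⊗[k] E) :
    g.lTensor B (f.rTensor E z) = f.rTensor W (g.lTensor A z) := by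
  have : g.lTensor B ∘ₗ f.rTensor E = f.rTensor W ∘ₗ g.lTensor A := by
    ext; simp
  exact LinearMap.congr_fun this z

theorem pent (z : ((A ⊗[k] B) ⊗[k] E) ⊗[k] W) :
    TensorProduct.assoc k A B (E ⊗[k] W) (TensorProduct.assoc k (A ⊗[k] B) E W z) =
      (TensorProduct.assoc k B E W).toLinearMap.lTensor A (TensorProduct.assoc k A (B ⊗[k] E) W
        ((TensorProduct.assoc k A B E).toLinearMap.rTensor W z)) := by
  have : (TensorProduct.assoc k A B (E ⊗[k] W)).toLinearMap ∘ₗ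
      (TensorProduct.assoc k (A ⊗[k] B) E W).toLinearMap =
      (TensorProduct.assoc k B E W).toLinearMap.lTensor A ∘ₗ
        (TensorProduct.assoc k A (B ⊗[k] E) W).toLinearMap ∘ₗ
        (TensorProduct.assoc k A B E).toLinearMap.rTensor W := by
    ext; simp
  exact LinearMap.congr_fun this z

variable {A' B' E' : Type*} [AddCommGroup A'] [Module k A'] [AddCommGroup B'] [Module k B']
  [AddCommGroup E'] [Module k E']

theorem rTensor_map (h : B →ₗ[k] B') (f : A →ₗ[k] B) (g : E →ₗ[k] W) (z : A ⊗[k] E) :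
    h.rTensor W (TensorProduct.map f g z) = TensorProduct.map (h ∘ₗ f) g z := by
  rw [← LinearMap.comp_apply, LinearMap.rTensor_comp_map]

theorem lTensor_map (h : W →ₗ[k] B') (f : A →ₗ[k] B) (g : E →ₗ[k] W) (z : A ⊗[k] E) :
    h.lTensor B (TensorProduct.map f g z) = TensorProduct.map f (h ∘ₗ g) z := by
  rw [← LinearMap.comp_apply, LinearMap.lTensor_comp_map]

theorem map_comp_right (f : A →ₗ[k] B) (h : W →ₗ[k] B') (g : E →ₗ[k] W) (z : A ⊗[k] E) :
    TensorProduct.map f (h ∘ₗ g) z = TensorProduct.map f h (g.lTensor A z) := by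
  rw [← LinearMap.comp_apply, LinearMap.map_comp_lTensor]

theorem map_comp_left (h : W →ₗ[k] B') (g : E →ₗ[k] W) (f : A →ₗ[k] B) (z : E ⊗[k] A) :
    TensorProduct.map (h ∘ₗ g) f z = TensorProduct.map h f (g.rTensor A z) := by
  rw [← LinearMap.comp_apply, LinearMap.map_comp_rTensor]

theorem map_map_assoc (f : A →ₗ[k] A') (g : B →ₗ[k] B') (h : E →ₗ[k] E')
    (z : (A ⊗[k] B) ⊗[k] E) :
    TensorProduct.assoc k A' B' E' (TensorProduct.map (TensorProduct.map f g) h z) =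
      TensorProduct.map f (TensorProduct.map g h) (TensorProduct.assoc k A B E z) :=
  (LinearMap.congr_fun (TensorProduct.map_map_comp_assoc_eq f g h) z).symm

theorem map_rTensor_assoc (f : A →ₗ[k] A') (g : B →ₗ[k] B') (z : (A ⊗[k] B) ⊗[k] E) :
    TensorProduct.assoc k A' B' E ((TensorProduct.map f g).rTensor E z) =
      TensorProduct.map f (g.rTensor E) (TensorProduct.assoc k A B E z) :=
  map_map_assoc f g LinearMap.id z

theorem map_sum_right {ι : Type*} (s : Finset ι) (f : A →ₗ[k] B) (g : ι → E →ₗ[k] W)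
    (z : A ⊗[k] E) :
    TensorProduct.map f (∑ i ∈ s, g i) z = ∑ i ∈ s, TensorProduct.map f (g i) z := by
  rw [← TensorProduct.mapBilinear_apply, map_sum, LinearMap.sum_apply]
  rfl

theorem map_eq_lTensor_rTensor (f : A →ₗ[k] B) (g : E →ₗ[k] W) (z : A ⊗[k] E) :
    TensorProduct.map f g z = g.lTensor B (f.rTensor E z) := by
  rw [← LinearMap.comp_apply, LinearMap.lTensor_comp_rTensor]

theorem map_eq_rTensor_lTensor (f : A →ₗ[k] B) (g : E →ₗ[k] W) (z : A ⊗[k] E) :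
    TensorProduct.map f g z = f.rTensor W (g.lTensor A z) := by
  rw [← LinearMap.comp_apply, LinearMap.rTensor_comp_lTensor]

end Factor

section Comodules

/-- Bicomodules over a coalgebra `C`: a left coaction `coactL` and a right coaction `coactR`, both
coassociative and counital, which commute with each other. -/
class Bicomodule (k C M : Type*) [Field k] [AddCommGroup C] [Module k C] [Coalgebra k C]
    [AddCommGroup M] [Module k M] where
  coactL : M →ₗ[k] C ⊗[k] M
  coactR : M →ₗ[k] M ⊗[k] C
  coassocL : ∀ m, TensorProduct.assoc k C C M (Coalgebra.comul.rTensor M (coactL m)) =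
    coactL.lTensor C (coactL m)
  counitL : ∀ m, Coalgebra.counit.rTensor M (coactL m) = (1 : k) ⊗ₜ[k] m
  coassocR : ∀ m, TensorProduct.assoc k M C C (coactR.rTensor C (coactR m)) =
    Coalgebra.comul.lTensor M (coactR m)
  counitR : ∀ m, Coalgebra.counit.lTensor M (coactR m) = m ⊗ₜ[k] (1 : k)
  coact_comm : ∀ m, TensorProduct.assoc k C M C (coactL.rTensor C (coactR m)) =
    coactR.lTensor C (coactL m)

open Bicomodule

universe u v w

/-- Left `C`-comodules, bundled. -/
structure LeftComod (k : Type u) (C : Type v) [Field k] [AddCommGroup C] [Module k C]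
    [Coalgebra k C] where
  carrier : Type w
  [addCommGroup : AddCommGroup carrier]
  [module : Module k carrier]
  coact : carrier →ₗ[k] C ⊗[k] carrier
  coassoc : ∀ x, TensorProduct.assoc k C C carrier (Coalgebra.comul.rTensor carrier (coact x)) =
    coact.lTensor C (coact x)
  counit : ∀ x, Coalgebra.counit.rTensor carrier (coact x) = (1 : k) ⊗ₜ[k] x

attribute [instance] LeftComod.addCommGroup LeftComod.module

variable (k : Type u) (C : Type v) (M : Type w) [Field k] [AddCommGroup C] [Module k C]
  [Coalgebra k C] [AddCommGroup M] [Module k M] [Bicomodule k C M]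

/-- The left comodule underlying a bicomodule. -/
abbrev Bicomodule.toLeftComod : LeftComod.{u, v, w} k C where
  carrier := M
  coact := coactL
  coassoc := coassocL
  counit := counitL

variable {k C}

/-- The cotensor product `M □ X ⊆ M ⊗ X` of a bicomodule `M` and a left comodule `X`: the
equalizer of the two maps `id ⊗ ρ` and `ρ ⊗ id` from `M ⊗ X` to `M ⊗ C ⊗ X`. -/
abbrev cotensor (X : LeftComod.{u, v, w} k C) : Submodule k (M ⊗[k] X.carrier) :=
  eqLocus (X.coact.lTensor M)
    ((TensorProduct.assoc k M C X.carrier).toLinearMap ∘ₗ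
      (coactR : M →ₗ[k] M ⊗[k] C).rTensor X.carrier)

theorem cotensor_coact_mem (X : LeftComod.{u, v, w} k C) (z : cotensor M X) :
    ((TensorProduct.assoc k C M X.carrier).toLinearMap ∘ₗ
      (coactL : M →ₗ[k] C ⊗[k] M).rTensor X.carrier ∘ₗ (cotensor M X).subtype) z ∈
      range ((cotensor M X).subtype.lTensor C) := by
  apply mem_range_lTensor
  have hz : X.coact.lTensor M z.1 = TensorProduct.assoc k M C X.carrier
    ((coactR : M →ₗ[k] M ⊗[k] C).rTensor X.carrier z.1) := z.2
  have hc : (coactR : M →ₗ[k] M ⊗[k] C).lTensor C ∘ₗ coactL =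
      (TensorProduct.assoc k C M C).toLinearMap ∘ₗ (coactL : M →ₗ[k] C ⊗[k] M).rTensor C ∘ₗ
        coactR := by
    ext m; exact (coact_comm m).symm
  simp only [LinearMap.comp_apply, LinearEquiv.coe_coe, Submodule.subtype_apply,
    lTensor_comp_apply]
  rw [nat1, interchange, hz, nat3, nat2, pent, ← rTensor_comp_apply, ← rTensor_comp_apply,
    ← rTensor_comp_apply, hc]
  rfl

/-- The left coaction of `M □ X`, given by the left coaction of `M`. -/
def cotensorCoact (X : LeftComod.{u, v, w} k C) : cotensor M X →ₗ[k] C ⊗[k] cotensor M X :=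
  factor ((cotensor M X).subtype.lTensor C) (lTensor_subtype_injective C _)
    ((TensorProduct.assoc k C M X.carrier).toLinearMap ∘ₗ
      (coactL : M →ₗ[k] C ⊗[k] M).rTensor X.carrier ∘ₗ (cotensor M X).subtype)
    (cotensor_coact_mem M X)

theorem cotensorCoact_apply (X : LeftComod.{u, v, w} k C) (z : cotensor M X) :
    (cotensor M X).subtype.lTensor C (cotensorCoact M X z) =
      TensorProduct.assoc k C M X.carrier
        ((coactL : M →ₗ[k] C ⊗[k] M).rTensor X.carrier z.1) :=
  factor_apply _ _ _ _ z

theorem cotensorCoact_comp (X : LeftComod.{u, v, w} k C) :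
    (cotensor M X).subtype.lTensor C ∘ₗ cotensorCoact M X =
      (TensorProduct.assoc k C M X.carrier).toLinearMap ∘ₗ
        (coactL : M →ₗ[k] C ⊗[k] M).rTensor X.carrier ∘ₗ (cotensor M X).subtype :=
  LinearMap.ext fun z => cotensorCoact_apply M X z

/-- The cotensor product `M □ X` as a left comodule. -/
abbrev cotensorComod (X : LeftComod.{u, v, w} k C) : LeftComod.{u, v, w} k C where
  carrier := cotensor M X
  coact := cotensorCoact M X
  coassoc z := by
    have hc : (TensorProduct.assoc k C C M).toLinearMap ∘ₗ
        (Coalgebra.comul (R := k) (A := C)).rTensor M ∘ₗ coactL =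
        (coactL : M →ₗ[k] C ⊗[k] M).lTensor C ∘ₗ coactL := by
      ext m; exact coassocL m
    have hinj : Function.Injective (((cotensor M X).subtype.lTensor C).lTensor C) :=
      Module.Flat.lTensor_preserves_injective_linearMap _ (lTensor_subtype_injective C _)
    apply hinj
    rw [nat1, interchange, cotensorCoact_apply, ← lTensor_comp_apply, cotensorCoact_comp,
      lTensor_comp_apply, lTensor_comp_apply, cotensorCoact_apply, nat2, nat3, pent,
      ← rTensor_comp_apply, ← rTensor_comp_apply, ← rTensor_comp_apply, LinearMap.comp_assoc, hc]
  counit z := by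
    have hc : (Coalgebra.counit (R := k) (A := C)).rTensor M ∘ₗ coactL =
        TensorProduct.mk k k M 1 := by
      ext m; exact counitL m
    apply lTensor_subtype_injective k (cotensor M X)
    rw [interchange, cotensorCoact_apply, nat3, ← rTensor_comp_apply, hc]
    simp only [lTensor_tmul, Submodule.subtype_apply]
    generalize z.1 = y
    induction y with
    | zero => simp
    | add a b ha hb => simp only [map_add, ha, hb, tmul_add]
    | tmul a b => simp

/-- Left colinearity of a map `X → Y ⊗ V`, where `C` coacts on `Y ⊗ V` through `Y`. -/
def IsColinear {X Y : LeftComod.{u, v, w} k C} {V : Type*} [AddCommGroup V] [Module k V]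
    (f : X.carrier →ₗ[k] Y.carrier ⊗[k] V) : Prop :=
  ∀ x, TensorProduct.assoc k C Y.carrier V (Y.coact.rTensor V (f x)) = f.lTensor C (X.coact x)

section CotensorMap

variable {X Y : LeftComod.{u, v, w} k C} {V : Type*} [AddCommGroup V] [Module k V]
  (f : X.carrier →ₗ[k] Y.carrier ⊗[k] V) (hf : IsColinear f)

/-- The restriction of `id ⊗ f : M ⊗ X → M ⊗ Y ⊗ V` to `M □ X`. -/
def cotensorMapAux : cotensor M X →ₗ[k] (M ⊗[k] Y.carrier) ⊗[k] V :=
  (TensorProduct.assoc k M Y.carrier V).symm.toLinearMap ∘ₗ f.lTensor M ∘ₗ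
    (cotensor M X).subtype

theorem cotensorMap_mem (hf : IsColinear f) (z : cotensor M X) :
    cotensorMapAux M f z ∈ range ((cotensor M Y).subtype.rTensor V) := by
  apply mem_range_rTensor
  have hz : X.coact.lTensor M z.1 = TensorProduct.assoc k M C X.carrier
    ((coactR : M →ₗ[k] M ⊗[k] C).rTensor X.carrier z.1) := z.2
  have hc : (TensorProduct.assoc k C Y.carrier V).toLinearMap ∘ₗ Y.coact.rTensor V ∘ₗ f =
      f.lTensor C ∘ₗ X.coact := LinearMap.ext hf
  apply (TensorProduct.assoc k M (C ⊗[k] Y.carrier) V).injective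
  apply ((TensorProduct.assoc k C Y.carrier V).lTensor M).injective
  change (TensorProduct.assoc k C Y.carrier V).toLinearMap.lTensor M _ =
    (TensorProduct.assoc k C Y.carrier V).toLinearMap.lTensor M _
  simp only [cotensorMapAux, LinearMap.comp_apply, LinearEquiv.coe_coe,
    Submodule.subtype_apply, rTensor_comp_apply]
  rw [← nat2, ← pent, ← nat3, LinearEquiv.apply_symm_apply, ← lTensor_comp_apply,
    ← lTensor_comp_apply, ← interchange, LinearMap.comp_assoc, hc, lTensor_comp_apply, hz, nat1]

/-- The map `M □ X → (M □ Y) ⊗ V` obtained by restricting `id ⊗ f` for a left colinear map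
`f : X → Y ⊗ V`. -/
def cotensorMap : cotensor M X →ₗ[k] cotensor M Y ⊗[k] V :=
  factor ((cotensor M Y).subtype.rTensor V) (rTensor_subtype_injective V _)
    (cotensorMapAux M f) (cotensorMap_mem M f hf)

theorem cotensorMap_apply (z : cotensor M X) :
    TensorProduct.assoc k M Y.carrier V
      ((cotensor M Y).subtype.rTensor V (cotensorMap M f hf z)) = f.lTensor M z.1 := by
  rw [cotensorMap, factor_apply]
  simp [cotensorMapAux]

theorem cotensorMap_comp :
    (TensorProduct.assoc k M Y.carrier V).toLinearMap ∘ₗ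
      (cotensor M Y).subtype.rTensor V ∘ₗ cotensorMap M f hf =
      f.lTensor M ∘ₗ (cotensor M X).subtype :=
  LinearMap.ext fun z => cotensorMap_apply M f hf z

theorem cotensorMap_isColinear :
    IsColinear (X := cotensorComod M X) (Y := cotensorComod M Y) (cotensorMap M f hf) := by
  intro z
  have hinj : Function.Injective (((TensorProduct.assoc k M Y.carrier V).toLinearMap ∘ₗ
      (cotensor M Y).subtype.rTensor V).lTensor C) :=
    Module.Flat.lTensor_preserves_injective_linearMap _
      (by
        rw [LinearMap.coe_comp]
        exact (LinearEquiv.injective _).comp (rTensor_subtype_injective V _))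
  apply hinj
  change ((TensorProduct.assoc k M Y.carrier V).toLinearMap ∘ₗ
      (cotensor M Y).subtype.rTensor V).lTensor C
      (TensorProduct.assoc k C (cotensor M Y) V ((cotensorCoact M Y).rTensor V
        (cotensorMap M f hf z))) = ((TensorProduct.assoc k M Y.carrier V).toLinearMap ∘ₗ
      (cotensor M Y).subtype.rTensor V).lTensor C
      ((cotensorMap M f hf).lTensor C (cotensorCoact M X z))
  rw [← lTensor_comp_apply C _ (cotensorMap M f hf), LinearMap.comp_assoc, cotensorMap_comp,
    lTensor_comp_apply, lTensor_comp_apply, nat2, ← rTensor_comp_apply, cotensorCoact_comp,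
    cotensorCoact_apply, rTensor_comp_apply, ← pent, nat1, interchange, ← cotensorMap_apply M f hf,
    nat3, rTensor_comp_apply]

variable (g : X.carrier →ₗ[k] V)

theorem inclusion_isColinear :
    IsColinear (X := cotensorComod M X) (Y := Bicomodule.toLeftComod k C M)
      (g.lTensor M ∘ₗ (cotensor M X).subtype) := by
  intro z
  change TensorProduct.assoc k C M V ((coactL : M →ₗ[k] C ⊗[k] M).rTensor V (g.lTensor M z.1)) =
    (g.lTensor M ∘ₗ (cotensor M X).subtype).lTensor C (cotensorCoact M X z)
  rw [lTensor_comp_apply, cotensorCoact_apply, nat1, interchange]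

variable (h : C →ₗ[k] V)

theorem coactR_isColinear :
    IsColinear (X := Bicomodule.toLeftComod k C M) (Y := Bicomodule.toLeftComod k C M)
      (h.lTensor M ∘ₗ coactR) := by
  intro m
  change TensorProduct.assoc k C M V ((coactL : M →ₗ[k] C ⊗[k] M).rTensor V
    (h.lTensor M (coactR m))) = (h.lTensor M ∘ₗ coactR).lTensor C (coactL m)
  rw [lTensor_comp_apply, ← coact_comm, nat1, interchange]

end CotensorMap

section Splitting

variable {M}
variable {W U V' : Type*} {X Y Z : LeftComod.{u, v, w} k C} {V : Type*} [AddCommGroup V]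
  [Module k V] [AddCommGroup U] [Module k U] [AddCommGroup V'] [Module k V']

theorem split_aux_coactR (h : C →ₗ[k] V) (d : V →ₗ[k] V ⊗[k] V)
    (hd : d ∘ₗ h = TensorProduct.map h h ∘ₗ Coalgebra.comul) (m : M) :
    d.lTensor M (h.lTensor M (coactR m)) = TensorProduct.assoc k M V V
      ((h.lTensor M ∘ₗ coactR).rTensor V (h.lTensor M (coactR m))) := by
  rw [← lTensor_comp_apply, hd, lTensor_comp_apply, ← coassocR, rTensor_comp_apply, ← interchange]
  generalize (coactR : M →ₗ[k] M ⊗[k] C).rTensor C (coactR m) = y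
  have : (TensorProduct.map h h).lTensor M ∘ₗ (TensorProduct.assoc k M C C).toLinearMap =
      (TensorProduct.assoc k M V V).toLinearMap ∘ₗ (h.lTensor M).rTensor V ∘ₗ
        h.lTensor (M ⊗[k] C) := by
    ext; simp
  exact LinearMap.congr_fun this y

theorem split_aux_incl_coactR (h : C →ₗ[k] V) (g : X.carrier →ₗ[k] V) (z : cotensor M X) :
    TensorProduct.assoc k M V V
      ((h.lTensor M ∘ₗ (coactR : M →ₗ[k] M ⊗[k] C)).rTensor V (g.lTensor M z.1)) =
      (TensorProduct.map h g ∘ₗ X.coact).lTensor M z.1 := by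
  have hz : X.coact.lTensor M z.1 = TensorProduct.assoc k M C X.carrier
    ((coactR : M →ₗ[k] M ⊗[k] C).rTensor X.carrier z.1) := z.2
  rw [lTensor_comp_apply, hz, rTensor_comp_apply, ← interchange]
  generalize (coactR : M →ₗ[k] M ⊗[k] C).rTensor X.carrier z.1 = y
  have : (TensorProduct.map h g).lTensor M ∘ₗ (TensorProduct.assoc k M C X.carrier).toLinearMap =
      (TensorProduct.assoc k M V V).toLinearMap ∘ₗ (h.lTensor M).rTensor V ∘ₗ
        g.lTensor (M ⊗[k] C) := by
    ext; simp
  exact (LinearMap.congr_fun this y).symm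

theorem split_aux_incl (f : X.carrier →ₗ[k] Y.carrier ⊗[k] V) (hf : IsColinear f)
    (g : Y.carrier →ₗ[k] U) (z : cotensor M X) :
    TensorProduct.assoc k M U V
      ((g.lTensor M ∘ₗ (cotensor M Y).subtype).rTensor V (cotensorMap M f hf z)) =
      (g.rTensor V ∘ₗ f).lTensor M z.1 := by
  rw [rTensor_comp_apply, ← nat2, cotensorMap_apply, lTensor_comp_apply]

theorem split_aux_injective (Y : LeftComod.{u, v, w} k C) (V : Type*) [AddCommGroup V]
    [Module k V] {y y' : cotensor M Y ⊗[k] V}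
    (h : TensorProduct.assoc k M Y.carrier V ((cotensor M Y).subtype.rTensor V y) =
      TensorProduct.assoc k M Y.carrier V ((cotensor M Y).subtype.rTensor V y')) : y = y' :=
  rTensor_subtype_injective V _ ((LinearEquiv.injective _) h)

theorem split_aux_map (f : X.carrier →ₗ[k] Y.carrier ⊗[k] V) (hf : IsColinear f)
    (d : V →ₗ[k] V') (z : cotensor M X) :
    TensorProduct.assoc k M Y.carrier V' ((cotensor M Y).subtype.rTensor V'
      (d.lTensor (cotensor M Y) (cotensorMap M f hf z))) =
      (d.lTensor Y.carrier ∘ₗ f).lTensor M z.1 := by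
  rw [← interchange, ← nat1, cotensorMap_apply, lTensor_comp_apply]

theorem split_aux_map_map (f : X.carrier →ₗ[k] Y.carrier ⊗[k] V) (hf : IsColinear f)
    (e : Y.carrier →ₗ[k] Z.carrier ⊗[k] U) (he : IsColinear e) (z : cotensor M X) :
    TensorProduct.assoc k M Z.carrier (U ⊗[k] V) ((cotensor M Z).subtype.rTensor (U ⊗[k] V)
      (TensorProduct.assoc k (cotensor M Z) U V
        ((cotensorMap M e he).rTensor V (cotensorMap M f hf z)))) =
      ((TensorProduct.assoc k Z.carrier U V).toLinearMap ∘ₗ e.rTensor V ∘ₗ f).lTensor M z.1 := by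
  rw [nat3, pent, ← rTensor_comp_apply, ← rTensor_comp_apply, LinearMap.comp_assoc,
    cotensorMap_comp, rTensor_comp_apply,
    ← nat2, cotensorMap_apply, lTensor_comp_apply, lTensor_comp_apply]

theorem cotensorMap_zero (h0 : IsColinear (0 : X.carrier →ₗ[k] Y.carrier ⊗[k] V)) :
    cotensorMap M (0 : X.carrier →ₗ[k] Y.carrier ⊗[k] V) h0 = 0 := by
  ext1 z
  apply split_aux_injective
  rw [cotensorMap_apply]
  simp

end Splitting

variable (k C)

/-- The iterated cotensor product `M □ ⋯ □ M` with `n + 1` factors, `M □ (M □ (⋯ □ M))`,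
as a left comodule. -/
def cotensorPow : ℕ → LeftComod.{u, v, w} k C
  | 0 => Bicomodule.toLeftComod k C M
  | n + 1 => cotensorComod M (cotensorPow n)

/-- The underlying space `C ⊕ M ⊕ (M □ M) ⊕ ⋯` of the cotensor coalgebra `T_C(M)`. -/
def CotensorCoalgebra : Type (max v w) := C × ⨁ n, (cotensorPow k C M n).carrier

instance : AddCommGroup (CotensorCoalgebra k C M) :=
  inferInstanceAs (AddCommGroup (C × ⨁ n, (cotensorPow k C M n).carrier))

instance : Module k (CotensorCoalgebra k C M) :=
  inferInstanceAs (Module k (C × ⨁ n, (cotensorPow k C M n).carrier))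

namespace CotensorCoalgebra

/-- The inclusion of `C`. -/
def ofC : C →ₗ[k] CotensorCoalgebra k C M := LinearMap.inl k C _

/-- The inclusion of the cotensor power with `n + 1` factors. -/
def ofPow (n : ℕ) : (cotensorPow k C M n).carrier →ₗ[k] CotensorCoalgebra k C M :=
  LinearMap.inr k C _ ∘ₗ DirectSum.lof k ℕ (fun n => (cotensorPow k C M n).carrier) n

/-- The linear map out of the cotensor coalgebra with given restrictions to its summands. -/
def desc {V : Type*} [AddCommGroup V] [Module k V] (f : C →ₗ[k] V)
    (g : ∀ n, (cotensorPow k C M n).carrier →ₗ[k] V) : CotensorCoalgebra k C M →ₗ[k] V :=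
  LinearMap.coprod f (DirectSum.toModule k ℕ V g)

/-- The part of the comultiplication on `M □ ⋯ □ M` (`n + 1` factors) whose left tensor factor
lies in `M □ ⋯ □ M` (`i + 1` factors): it maps `m₀ □ ⋯ □ mₙ` to
`(m₀ □ ⋯ □ mᵢ) ⊗ (mᵢ₊₁ □ ⋯ □ mₙ)` if `i < n`, to
`∑ (m₀ □ ⋯ □ (mₙ)₀) ⊗ (mₙ)₁`, where `∑ (mₙ)₀ ⊗ (mₙ)₁ ∈ M ⊗ C` is the right coaction on `mₙ`,
if `i = n`, and to `0` if `i > n`. -/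
def splitAux : (n i : ℕ) →
    {f : (cotensorPow k C M n).carrier →ₗ[k]
      (cotensorPow k C M i).carrier ⊗[k] CotensorCoalgebra k C M // IsColinear f}
  | 0, 0 => ⟨(ofC k C M).lTensor M ∘ₗ (coactR : M →ₗ[k] M ⊗[k] C),
      coactR_isColinear M (ofC k C M)⟩
  | 0, _ + 1 => ⟨0, fun x => by simp⟩
  | n + 1, 0 => ⟨(ofPow k C M n).lTensor M ∘ₗ (cotensor M (cotensorPow k C M n)).subtype,
      inclusion_isColinear M _⟩
  | n + 1, i + 1 => ⟨cotensorMap M (splitAux n i).1 (splitAux n i).2,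
      cotensorMap_isColinear M _ _⟩

/-- The map underlying `splitAux`. -/
def split (n i : ℕ) : (cotensorPow k C M n).carrier →ₗ[k]
    (cotensorPow k C M i).carrier ⊗[k] CotensorCoalgebra k C M := (splitAux k C M n i).1

instance : CoalgebraStruct k (CotensorCoalgebra k C M) where
  comul := desc k C M
    (TensorProduct.map (ofC k C M) (ofC k C M) ∘ₗ Coalgebra.comul)
    (fun n => TensorProduct.map (ofC k C M) (ofPow k C M n) ∘ₗ (cotensorPow k C M n).coact +
      ∑ i ∈ Finset.range (n + 1), (ofPow k C M i).rTensor _ ∘ₗ split k C M n i)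
  counit := desc k C M Coalgebra.counit (fun _ => 0)

end CotensorCoalgebra

namespace CotensorCoalgebra

variable {k C M}

theorem desc_ofC {V : Type*} [AddCommGroup V] [Module k V] (f : C →ₗ[k] V)
    (g : ∀ n, (cotensorPow k C M n).carrier →ₗ[k] V) (c : C) :
    desc k C M f g (ofC k C M c) = f c :=
  LinearMap.congr_fun (LinearMap.coprod_inl f (DirectSum.toModule k ℕ V g)) c

theorem desc_ofPow {V : Type*} [AddCommGroup V] [Module k V] (f : C →ₗ[k] V)
    (g : ∀ n, (cotensorPow k C M n).carrier →ₗ[k] V) (n : ℕ)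
    (x : (cotensorPow k C M n).carrier) :
    desc k C M f g (ofPow k C M n x) = g n x :=
  (LinearMap.congr_fun (LinearMap.coprod_inr f (DirectSum.toModule k ℕ V g)) _).trans
    (DirectSum.toModule_lof (φ := g) k n x)

theorem comul_ofC (c : C) : Coalgebra.comul (R := k) (ofC k C M c) =
    TensorProduct.map (ofC k C M) (ofC k C M) (Coalgebra.comul (R := k) c) :=
  desc_ofC _ _ c

theorem comul_ofPow (n : ℕ) (x : (cotensorPow k C M n).carrier) :
    Coalgebra.comul (R := k) (ofPow k C M n x) =
    TensorProduct.map (ofC k C M) (ofPow k C M n) ((cotensorPow k C M n).coact x) +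
      ∑ i ∈ Finset.range (n + 1), (ofPow k C M i).rTensor _ (split k C M n i x) := by
  refine (desc_ofPow _ _ n x).trans ?_
  simp [LinearMap.sum_apply]

theorem counit_ofC (c : C) :
    Coalgebra.counit (R := k) (ofC k C M c) = Coalgebra.counit (R := k) c :=
  desc_ofC _ _ c

theorem counit_ofPow (n : ℕ) (x : (cotensorPow k C M n).carrier) :
    Coalgebra.counit (R := k) (ofPow k C M n x) = 0 :=
  desc_ofPow _ _ n x

theorem hom_ext {V : Type*} [AddCommGroup V] [Module k V] {f g : CotensorCoalgebra k C M →ₗ[k] V}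
    (h0 : ∀ c, f (ofC k C M c) = g (ofC k C M c))
    (h1 : ∀ n x, f (ofPow k C M n x) = g (ofPow k C M n x)) : f = g := by
  apply LinearMap.prod_ext
  · exact LinearMap.ext h0
  · apply DirectSum.linearMap_ext
    intro n
    exact LinearMap.ext (h1 n)

theorem split_zero_zero (m : M) :
    split k C M 0 0 m = (ofC k C M).lTensor M (coactR (k := k) (C := C) m) := rfl

theorem split_succ_zero (n : ℕ) (z : cotensor M (cotensorPow k C M n)) :
    split k C M (n + 1) 0 z = (ofPow k C M n).lTensor M z.1 := rfl

/-- The comultiplication on `M` is the sum of the left and the right coaction. -/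
theorem comul_ofPow_zero (m : M) :
    let ι : M →ₗ[k] CotensorCoalgebra k C M := ofPow k C M 0
    Coalgebra.comul (R := k) (ι m) =
      TensorProduct.map (ofC k C M) ι ((coactL : M →ₗ[k] C ⊗[k] M) m) +
        TensorProduct.map ι (ofC k C M) ((coactR : M →ₗ[k] M ⊗[k] C) m) := by
  intro ι
  refine (comul_ofPow 0 m).trans ?_
  rw [Finset.sum_range_one]
  congr 1
  exact (map_eq_rTensor_lTensor ι (ofC k C M) ((coactR : M →ₗ[k] M ⊗[k] C) m)).symm

theorem split_zero_succ (i : ℕ) : split k C M 0 (i + 1) = 0 := rfl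

theorem split_colinear (n i : ℕ) : IsColinear (split k C M n i) := (splitAux k C M n i).2

theorem split_eq_zero : ∀ {n i : ℕ}, n < i → split k C M n i = 0
  | 0, _ + 1, _ => rfl
  | n + 1, i + 1, h => by
    have h1 := split_eq_zero (n := n) (i := i) (by omega)
    have h2 : ∀ (f : _ →ₗ[k] _) (hf : IsColinear f), f = 0 →
        cotensorMap (X := cotensorPow k C M n) (Y := cotensorPow k C M i)
          (V := CotensorCoalgebra k C M) M f hf = 0 := by
      rintro f hf rfl
      exact cotensorMap_zero hf
    exact h2 _ (split_colinear n i) h1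

theorem split_split : ∀ (n i : ℕ) (x : (cotensorPow k C M n).carrier),
    (Coalgebra.comul (R := k) (A := CotensorCoalgebra k C M)).lTensor _ (split k C M n i x) =
      ∑ l ∈ Finset.range (n + 1), TensorProduct.assoc k _ _ _
        ((split k C M l i).rTensor _ (split k C M n l x))
  | 0, 0, x => by
    rw [Finset.sum_range_one]
    exact split_aux_coactR (M := M) (ofC k C M) Coalgebra.comul (LinearMap.ext comul_ofC) x
  | 0, i + 1, x => by
    simp [split_zero_succ]
  | n + 1, 0, x => by
    rw [Finset.sum_range_succ']
    have h0 := split_aux_incl_coactR (ofC k C M) (ofPow k C M n) x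
    have h1 := fun l => split_aux_incl (split k C M n l) (split_colinear n l) (ofPow k C M l) x
    have h2 : (Coalgebra.comul (R := k)) ∘ₗ ofPow k C M n = ∑ l ∈ Finset.range (n + 1),
        (ofPow k C M l).rTensor _ ∘ₗ (split k C M n l) +
        TensorProduct.map (ofC k C M) (ofPow k C M n) ∘ₗ (cotensorPow k C M n).coact := by
      ext1 y
      simp [comul_ofPow, add_comm, LinearMap.sum_apply]
    have h3 : (Coalgebra.comul (R := k)).lTensor M ((ofPow k C M n).lTensor M x.1) =
        ∑ l ∈ Finset.range (n + 1),
          ((ofPow k C M l).rTensor _ ∘ₗ (split k C M n l)).lTensor M x.1 +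
        (TensorProduct.map (ofC k C M) (ofPow k C M n) ∘ₗ
          (cotensorPow k C M n).coact).lTensor M x.1 := by
      rw [← lTensor_comp_apply, h2, lTensor_add, LinearMap.add_apply]
      congr 1
      rw [← coe_lTensorHom, map_sum, LinearMap.sum_apply]
    refine h3.trans ?_
    exact congrArg₂ _ (Finset.sum_congr rfl fun l _ => (h1 l).symm) h0.symm
  | n + 1, i + 1, x => by
    rw [Finset.sum_range_succ', split_zero_succ, LinearMap.rTensor_zero, LinearMap.zero_apply,
      map_zero, add_zero]
    apply split_aux_injective (cotensorPow k C M i)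
    have h0 := split_aux_map (split k C M n i) (split_colinear n i)
      (Coalgebra.comul (R := k) (A := CotensorCoalgebra k C M)) x
    refine h0.trans ?_
    have h1 := fun l => split_aux_map_map (split k C M n l) (split_colinear n l)
      (split k C M l i) (split_colinear l i) x
    have h2 : (Coalgebra.comul (R := k) (A := CotensorCoalgebra k C M)).lTensor _ ∘ₗ
        split k C M n i = ∑ l ∈ Finset.range (n + 1),
          (TensorProduct.assoc k _ _ _).toLinearMap ∘ₗ (split k C M l i).rTensor _ ∘ₗ
            split k C M n l := by
      ext1 y
      simp [split_split n i y, LinearMap.sum_apply]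
    have h3 : ∀ y : M ⊗[k] (cotensorPow k C M n).carrier,
        ((Coalgebra.comul (R := k) (A := CotensorCoalgebra k C M)).lTensor _ ∘ₗ
          split k C M n i).lTensor M y = ∑ l ∈ Finset.range (n + 1),
          ((TensorProduct.assoc k _ _ _).toLinearMap ∘ₗ (split k C M l i).rTensor _ ∘ₗ
            split k C M n l).lTensor M y := by
      intro y
      rw [h2, ← coe_lTensorHom, map_sum, LinearMap.sum_apply]
    refine (h3 x.1).trans (Eq.trans ?_ (map_sum ((TensorProduct.assoc k M _ _).toLinearMap ∘ₗ
      (cotensor M (cotensorPow k C M i)).subtype.rTensor (CotensorCoalgebra k C M ⊗[k]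
        CotensorCoalgebra k C M)) _ _).symm)
    exact Finset.sum_congr rfl fun l _ => (h1 l).symm

theorem split_counit_self : ∀ (n : ℕ) (x : (cotensorPow k C M n).carrier),
    (Coalgebra.counit (R := k) (A := CotensorCoalgebra k C M)).lTensor _ (split k C M n n x) =
      x ⊗ₜ[k] (1 : k)
  | 0, x => by
    have h : (Coalgebra.counit (R := k) (A := CotensorCoalgebra k C M)) ∘ₗ ofC k C M =
      Coalgebra.counit := LinearMap.ext counit_ofC
    have h1 : (Coalgebra.counit (R := k) (A := CotensorCoalgebra k C M)).lTensor M
        ((ofC k C M).lTensor M (coactR (x : M))) = (x : M) ⊗ₜ[k] (1 : k) := by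
      rw [← lTensor_comp_apply, h]
      exact counitR (M := M) x
    exact h1
  | n + 1, x => by
    apply split_aux_injective (cotensorPow k C M n)
    have h0 := split_aux_map (split k C M n n) (split_colinear n n)
      (Coalgebra.counit (R := k) (A := CotensorCoalgebra k C M)) x
    refine h0.trans ?_
    have h2 : (Coalgebra.counit (R := k) (A := CotensorCoalgebra k C M)).lTensor _ ∘ₗ
        split k C M n n = (TensorProduct.mk k (cotensorPow k C M n).carrier k).flip 1 :=
      LinearMap.ext (split_counit_self n)
    rw [h2]
    have h3 : ∀ y : M ⊗[k] (cotensorPow k C M n).carrier,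
        ((TensorProduct.mk k (cotensorPow k C M n).carrier k).flip 1).lTensor M y =
        TensorProduct.assoc k M (cotensorPow k C M n).carrier k (y ⊗ₜ 1) := by
      intro y
      induction y with
      | zero => simp
      | add a b ha hb => simp only [map_add, ha, hb, add_tmul]
      | tmul a b => simp
    rw [h3]
    rfl

theorem split_counit_lt : ∀ (n i : ℕ) (_ : i < n) (x : (cotensorPow k C M n).carrier),
    (Coalgebra.counit (R := k) (A := CotensorCoalgebra k C M)).lTensor _ (split k C M n i x) = 0
  | n + 1, 0, _, x => by
    have h : (Coalgebra.counit (R := k) (A := CotensorCoalgebra k C M)) ∘ₗ ofPow k C M n = 0 :=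
      LinearMap.ext (counit_ofPow n)
    have h1 : (Coalgebra.counit (R := k) (A := CotensorCoalgebra k C M)).lTensor M
        ((ofPow k C M n).lTensor M x.1) = 0 := by
      rw [← lTensor_comp_apply, h]
      simp
    exact h1
  | n + 1, i + 1, h, x => by
    apply split_aux_injective (cotensorPow k C M i)
    have h0 := split_aux_map (split k C M n i) (split_colinear n i)
      (Coalgebra.counit (R := k) (A := CotensorCoalgebra k C M)) x
    refine h0.trans ?_
    have h2 : (Coalgebra.counit (R := k) (A := CotensorCoalgebra k C M)).lTensor _ ∘ₗ
        split k C M n i = 0 :=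
      LinearMap.ext (split_counit_lt n i (by omega))
    rw [h2]
    refine Eq.trans (by simp) (map_zero ((TensorProduct.assoc k M _ _).toLinearMap ∘ₗ
      (cotensor M (cotensorPow k C M i)).subtype.rTensor k)).symm

theorem sum_split_of_le {V : Type*} [AddCommGroup V] [Module k V] {n N : ℕ} (h : n ≤ N)
    (F : ∀ i, (cotensorPow k C M i).carrier ⊗[k] CotensorCoalgebra k C M →ₗ[k] V)
    (x : (cotensorPow k C M n).carrier) :
    ∑ i ∈ Finset.range (n + 1), F i (split k C M n i x) =
      ∑ i ∈ Finset.range (N + 1), F i (split k C M n i x) := by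
  apply Finset.sum_subset
  · intro i hi
    simp only [Finset.mem_range] at hi ⊢
    omega
  · intro i _ hi
    simp only [Finset.mem_range, not_lt] at hi
    rw [split_eq_zero (by omega), LinearMap.zero_apply, map_zero]

theorem comul_comp_ofPow {i n : ℕ} (h : i ≤ n) :
    Coalgebra.comul (R := k) ∘ₗ ofPow k C M i =
      TensorProduct.map (ofC k C M) (ofPow k C M i) ∘ₗ (cotensorPow k C M i).coact +
      ∑ j ∈ Finset.range (n + 1), (ofPow k C M j).rTensor _ ∘ₗ split k C M i j := by
  ext1 x
  rw [LinearMap.comp_apply, comul_ofPow, sum_split_of_le h (fun j => (ofPow k C M j).rTensor _)]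
  simp [LinearMap.sum_apply]

theorem coassoc_ofC (c : C) :
    TensorProduct.assoc k _ _ _ ((Coalgebra.comul (R := k)).rTensor (CotensorCoalgebra k C M)
      (Coalgebra.comul (R := k) (ofC k C M c))) =
    (Coalgebra.comul (R := k)).lTensor (CotensorCoalgebra k C M)
      (Coalgebra.comul (R := k) (ofC k C M c)) := by
  have hc : Coalgebra.comul (R := k) ∘ₗ ofC k C M =
    TensorProduct.map (ofC k C M) (ofC k C M) ∘ₗ Coalgebra.comul := LinearMap.ext comul_ofC
  rw [comul_ofC, rTensor_map, lTensor_map, hc, map_comp_right, map_comp_left,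
    ← Coalgebra.coassoc_apply]
  rw [map_map_assoc]

theorem coassoc_ofPow (n : ℕ) (x : (cotensorPow k C M n).carrier) :
    TensorProduct.assoc k _ _ _ ((Coalgebra.comul (R := k)).rTensor (CotensorCoalgebra k C M)
      (Coalgebra.comul (R := k) (ofPow k C M n x))) =
    (Coalgebra.comul (R := k)).lTensor (CotensorCoalgebra k C M)
      (Coalgebra.comul (R := k) (ofPow k C M n x)) := by
  have hc : Coalgebra.comul (R := k) ∘ₗ ofC k C M =
    TensorProduct.map (ofC k C M) (ofC k C M) ∘ₗ Coalgebra.comul := LinearMap.ext comul_ofC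
  have hL : ∀ i ∈ Finset.range (n + 1), TensorProduct.assoc k _ _ _
      ((Coalgebra.comul (R := k)).rTensor (CotensorCoalgebra k C M)
        ((ofPow k C M i).rTensor _ (split k C M n i x))) =
      TensorProduct.map (ofC k C M) ((ofPow k C M i).rTensor _ ∘ₗ split k C M n i)
        ((cotensorPow k C M n).coact x) +
      ∑ j ∈ Finset.range (n + 1), (ofPow k C M j).rTensor _ (TensorProduct.assoc k _ _ _
        ((split k C M i j).rTensor _ (split k C M n i x))) := by
    intro i hi
    rw [← rTensor_comp_apply, comul_comp_ofPow (n := n) (by simpa [Nat.lt_succ_iff] using hi),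
      rTensor_add, LinearMap.add_apply, map_add, ← coe_rTensorHom, map_sum, LinearMap.sum_apply,
      map_sum]
    simp only [coe_rTensorHom]
    congr 1
    · have := split_colinear n i x
      rw [map_comp_right (f := ofC k C M), ← this, rTensor_comp_apply, map_rTensor_assoc]
    · refine Finset.sum_congr rfl fun j _ => ?_
      rw [nat3, ← rTensor_comp_apply]
  have hR : ∀ j ∈ Finset.range (n + 1),
      (Coalgebra.comul (R := k)).lTensor (CotensorCoalgebra k C M)
        ((ofPow k C M j).rTensor _ (split k C M n j x)) =
      ∑ l ∈ Finset.range (n + 1), (ofPow k C M j).rTensor _ (TensorProduct.assoc k _ _ _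
        ((split k C M l j).rTensor _ (split k C M n l x))) := by
    intro j _
    rw [interchange, split_split, map_sum]
  rw [comul_ofPow]
  simp only [map_add, map_sum]
  rw [Finset.sum_congr rfl hL, Finset.sum_congr rfl hR, Finset.sum_add_distrib, Finset.sum_comm,
    ← add_assoc]
  congr 1
  rw [rTensor_map, lTensor_map, hc, comul_comp_ofPow le_rfl, map_add_right, LinearMap.add_apply,
    map_sum_right]
  congr 1
  rw [map_comp_left, map_map_assoc, (cotensorPow k C M n).coassoc, map_comp_right]

/-- The cotensor coalgebra. -/
instance : Coalgebra k (CotensorCoalgebra k C M) where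
  coassoc := hom_ext coassoc_ofC coassoc_ofPow
  rTensor_counit_comp_comul := by
    apply hom_ext
    · intro c
      have hc : Coalgebra.counit (R := k) ∘ₗ ofC k C M = Coalgebra.counit := LinearMap.ext counit_ofC
      rw [LinearMap.comp_apply, comul_ofC, rTensor_map, hc, map_eq_lTensor_rTensor,
        Coalgebra.rTensor_counit_comul]
      simp
    · intro n x
      have hc : Coalgebra.counit (R := k) ∘ₗ ofC k C M = Coalgebra.counit := LinearMap.ext counit_ofC
      have hp : ∀ i, Coalgebra.counit (R := k) ∘ₗ ofPow k C M i = 0 :=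
        fun i => LinearMap.ext (counit_ofPow i)
      rw [LinearMap.comp_apply, comul_ofPow, map_add, map_sum, rTensor_map, hc,
        map_eq_lTensor_rTensor, (cotensorPow k C M n).counit]
      rw [Finset.sum_eq_zero]
      · simp
      · intro i _
        rw [← rTensor_comp_apply, hp]
        simp
  lTensor_counit_comp_comul := by
    apply hom_ext
    · intro c
      have hc : Coalgebra.counit (R := k) ∘ₗ ofC k C M = Coalgebra.counit := LinearMap.ext counit_ofC
      rw [LinearMap.comp_apply, comul_ofC, lTensor_map, hc, map_eq_rTensor_lTensor,
        Coalgebra.lTensor_counit_comul]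
      simp
    · intro n x
      have hp : ∀ i, Coalgebra.counit (R := k) ∘ₗ ofPow k C M i = 0 :=
        fun i => LinearMap.ext (counit_ofPow i)
      rw [LinearMap.comp_apply, comul_ofPow, map_add, map_sum, lTensor_map, hp, map_zero_right,
        LinearMap.zero_apply, zero_add, Finset.sum_eq_single n]
      · rw [interchange, split_counit_self]
        simp
      · intro i hi hne
        have hlt : i < n := by
          simp only [Finset.mem_range] at hi
          omega
        rw [interchange, split_counit_lt n i hlt, map_zero]
      · simp

end CotensorCoalgebra

end Comodules

section Dual

open Module

variable {k : Type*} [Field k]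
section

variable {A B E : Type*} [AddCommGroup A] [Module k A] [AddCommGroup B] [Module k B]
  [AddCommGroup E] [Module k E]

/-- The evaluation of an element of `A* ⊗ (B* ⊗ E*)` as a functional on `A ⊗ (B ⊗ E)`. -/
def dualDistrib₃ : Dual k A ⊗[k] (Dual k B ⊗[k] Dual k E) →ₗ[k] Dual k (A ⊗[k] (B ⊗[k] E)) :=
  dualDistrib k A (B ⊗[k] E) ∘ₗ (dualDistrib k B E).lTensor (Dual k A)

theorem dualDistrib₃_assoc (u : Dual k A ⊗[k] Dual k B) (g : Dual k E) (a : A) (b : B) (e : E) :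
    dualDistrib₃ (TensorProduct.assoc k _ _ _ (u ⊗ₜ[k] g)) (a ⊗ₜ[k] (b ⊗ₜ[k] e)) =
      dualDistrib k A B u (a ⊗ₜ b) * g e := by
  induction u with
  | zero =>
    simp only [zero_tmul, LinearEquiv.map_zero, LinearMap.map_zero, LinearMap.zero_apply, zero_mul]
  | add x y hx hy => simp only [add_tmul, LinearEquiv.map_add, LinearMap.map_add, LinearMap.add_apply, hx, hy, add_mul]
  | tmul x y => simp [dualDistrib₃, mul_assoc]

theorem dualDistrib₃_tmul (u : Dual k B ⊗[k] Dual k E) (g : Dual k A) (a : A) (b : B) (e : E) :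
    dualDistrib₃ (g ⊗ₜ[k] u) (a ⊗ₜ[k] (b ⊗ₜ[k] e)) = g a * dualDistrib k B E u (b ⊗ₜ e) := by
  simp [dualDistrib₃]

end

variable {A B E X Y L : Type*} [AddCommGroup A] [Module k A] [FiniteDimensional k A]
  [AddCommGroup B] [Module k B] [FiniteDimensional k B]
  [AddCommGroup E] [Module k E] [FiniteDimensional k E]
  [AddCommGroup X] [Module k X] [FiniteDimensional k X]
  [AddCommGroup Y] [Module k Y] [FiniteDimensional k Y]
  [AddCommGroup L] [Module k L]

/-- The map `L* → (A ⊗ B)* = A* ⊗ B*` dual to a map `A ⊗ B → L`, for finite-dimensional `A`, `B`. -/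
def codual (μ : A ⊗[k] B →ₗ[k] L) : Dual k L →ₗ[k] Dual k A ⊗[k] Dual k B :=
  (dualDistribEquiv k A B).symm.toLinearMap ∘ₗ μ.dualMap

theorem dualDistrib_codual (μ : A ⊗[k] B →ₗ[k] L) (f : Dual k L) :
    dualDistrib k A B (codual μ f) = f ∘ₗ μ :=
  (dualDistribEquiv k A B).apply_symm_apply (μ.dualMap f)

theorem dualDistrib_injective : Function.Injective (dualDistrib k A B) :=
  (dualDistribEquiv k A B).injective

theorem dualDistrib₃_injective : Function.Injective (dualDistrib₃ (k := k) (A := A) (B := B)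
    (E := E)) := by
  rw [dualDistrib₃, LinearMap.coe_comp]
  exact dualDistrib_injective.comp
    (Module.Flat.lTensor_preserves_injective_linearMap _ dualDistrib_injective)

theorem codual_assoc (μ : A ⊗[k] B →ₗ[k] X) (ν : X ⊗[k] E →ₗ[k] L) (μ' : B ⊗[k] E →ₗ[k] Y)
    (ν' : A ⊗[k] Y →ₗ[k] L)
    (h : ∀ a b e, ν (μ (a ⊗ₜ b) ⊗ₜ e) = ν' (a ⊗ₜ μ' (b ⊗ₜ e))) (f : Dual k L) :
    TensorProduct.assoc k _ _ _ ((codual μ).rTensor (Dual k E) (codual ν f)) =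
      (codual μ').lTensor (Dual k A) (codual ν' f) := by
  have h1 : ∀ (w : Dual k X ⊗[k] Dual k E) (a : A) (b : B) (e : E),
      dualDistrib₃ (TensorProduct.assoc k _ _ _ ((codual μ).rTensor (Dual k E) w))
        (a ⊗ₜ[k] (b ⊗ₜ[k] e)) = dualDistrib k X E w (μ (a ⊗ₜ b) ⊗ₜ e) := by
    intro w a b e
    induction w with
    | zero => simp only [LinearEquiv.map_zero, LinearMap.map_zero, LinearMap.zero_apply]
    | add x y hx hy => simp only [LinearEquiv.map_add, LinearMap.map_add, LinearMap.add_apply, hx, hy]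
    | tmul x y => rw [rTensor_tmul, dualDistrib₃_assoc, dualDistrib_codual]; simp
  have h2 : ∀ (w : Dual k A ⊗[k] Dual k Y) (a : A) (b : B) (e : E),
      dualDistrib₃ ((codual μ').lTensor (Dual k A) w)
        (a ⊗ₜ[k] (b ⊗ₜ[k] e)) = dualDistrib k A Y w (a ⊗ₜ μ' (b ⊗ₜ e)) := by
    intro w a b e
    induction w with
    | zero => simp
    | add x y hx hy => simp only [LinearMap.map_add, LinearMap.add_apply, hx, hy]
    | tmul x y => rw [lTensor_tmul, dualDistrib₃_tmul, dualDistrib_codual]; simp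
  apply dualDistrib₃_injective
  apply TensorProduct.ext
  ext a b e
  simp only [TensorProduct.mk_apply,
    AlgebraTensorModule.curry_apply, LinearMap.restrictScalars_self, TensorProduct.curry_apply,
    LinearMap.compr₂ₛₗ_apply]
  rw [h1, h2, dualDistrib_codual, dualDistrib_codual, LinearMap.comp_apply, LinearMap.comp_apply, h]

theorem codual_counit_left (μ : A ⊗[k] B →ₗ[k] B) (a : A) (h : ∀ b, μ (a ⊗ₜ b) = b)
    (f : Dual k B) :
    (Dual.eval k A a).rTensor (Dual k B) (codual μ f) = (1 : k) ⊗ₜ[k] f := by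
  have h1 : ∀ (w : Dual k A ⊗[k] Dual k B) (b : B),
      TensorProduct.lid k (Dual k B) ((Dual.eval k A a).rTensor (Dual k B) w) b =
        dualDistrib k A B w (a ⊗ₜ b) := by
    intro w b
    induction w with
    | zero => simp
    | add x y hx hy => simp only [LinearEquiv.map_add, LinearMap.map_add, LinearMap.add_apply, hx, hy]
    | tmul x y => simp
  apply (TensorProduct.lid k (Dual k B)).injective
  ext b
  rw [h1, dualDistrib_codual, LinearMap.comp_apply, h]
  simp

theorem codual_counit_right (μ : B ⊗[k] A →ₗ[k] B) (a : A) (h : ∀ b, μ (b ⊗ₜ a) = b)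
    (f : Dual k B) :
    (Dual.eval k A a).lTensor (Dual k B) (codual μ f) = f ⊗ₜ[k] (1 : k) := by
  have h1 : ∀ (w : Dual k B ⊗[k] Dual k A) (b : B),
      TensorProduct.rid k (Dual k B) ((Dual.eval k A a).lTensor (Dual k B) w) b =
        dualDistrib k B A w (b ⊗ₜ a) := by
    intro w b
    induction w with
    | zero => simp
    | add x y hx hy => simp only [LinearEquiv.map_add, LinearMap.map_add, LinearMap.add_apply, hx, hy]
    | tmul x y => simp [mul_comm]
  apply (TensorProduct.rid k (Dual k B)).injective
  ext b
  rw [h1, dualDistrib_codual, LinearMap.comp_apply, h]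
  simp

section Actions

variable (k) (D M : Type*) [Ring D] [Algebra k D] [AddCommGroup M] [Module k M]

/-- The left action `D ⊗ M → M`. -/
def leftAct [Module D M] [IsScalarTower k D M] : D ⊗[k] M →ₗ[k] M :=
  TensorProduct.lift (Algebra.lsmul k k M).toLinearMap

/-- The right action `M ⊗ D → M`. -/
def rightAct [Module Dᵐᵒᵖ M] [IsScalarTower k Dᵐᵒᵖ M] : M ⊗[k] D →ₗ[k] M :=
  TensorProduct.lift ((Algebra.lsmul k k M).toLinearMap ∘ₗ
    (MulOpposite.opLinearEquiv k : D ≃ₗ[k] Dᵐᵒᵖ).toLinearMap).flip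

@[simp] theorem leftAct_tmul [Module D M] [IsScalarTower k D M] (d : D) (m : M) :
    leftAct k D M (d ⊗ₜ m) = d • m := rfl

@[simp] theorem rightAct_tmul [Module Dᵐᵒᵖ M] [IsScalarTower k Dᵐᵒᵖ M] (m : M) (d : D) :
    rightAct k D M (m ⊗ₜ d) = MulOpposite.op d • m := rfl

end Actions

section Algebra

variable (k) (D M : Type*) [Ring D] [Algebra k D] [FiniteDimensional k D]

/-- The coalgebra `D*` dual to a finite-dimensional algebra `D`: the comultiplication is dual to
the multiplication of `D` and the counit is evaluation at `1`. -/
instance dualCoalgebra : Coalgebra k (Dual k D) where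
  comul := codual (LinearMap.mul' k D)
  counit := Dual.eval k D 1
  coassoc := LinearMap.ext fun f => codual_assoc _ _ _ _ (by simp [mul_assoc]) f
  rTensor_counit_comp_comul := LinearMap.ext fun f => codual_counit_left _ 1 (by simp) f
  lTensor_counit_comp_comul := LinearMap.ext fun f => codual_counit_right _ 1 (by simp) f

variable [AddCommGroup M] [Module k M] [FiniteDimensional k M] [Module D M] [Module Dᵐᵒᵖ M]
  [IsScalarTower k D M] [IsScalarTower k Dᵐᵒᵖ M] [SMulCommClass D Dᵐᵒᵖ M]

/-- The `D*`-bicomodule `M*` dual to a finite-dimensional `D`-bimodule `M`: the left coaction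
`M* → D* ⊗ M*` is dual to the left action `D ⊗ M → M`, and the right coaction `M* → M* ⊗ D*` is
dual to the right action `M ⊗ D → M`. -/
instance dualBicomodule : Bicomodule k (Dual k D) (Dual k M) where
  coactL := codual (leftAct k D M)
  coactR := codual (rightAct k D M)
  coassocL := codual_assoc _ _ _ _ (by simp [mul_smul])
  counitL := codual_counit_left _ 1 (by simp)
  coassocR := codual_assoc _ _ _ _ (by simp [mul_smul])
  counitR := codual_counit_right _ 1 (by simp)
  coact_comm := codual_assoc _ _ _ _ (by simp [smul_comm])

end Algebra

end Dual

section Chain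

theorem map_subtype_injective {k C : Type*} [Field k] [AddCommGroup C] [Module k C]
    (N : Submodule k C) :
    Function.Injective (TensorProduct.map N.subtype N.subtype) := by
  rw [← LinearMap.rTensor_comp_lTensor, LinearMap.coe_comp]
  exact (rTensor_subtype_injective C N).comp (lTensor_subtype_injective N N)

variable (k C : Type*) [Field k] [AddCommGroup C] [Module k C] [Coalgebra k C]

variable {k C} in
/-- Right coideals of `C`, that is, right subcomodules of `C`: subspaces `N` with
`Δ(N) ⊆ N ⊗ C`. -/
def IsRightCoideal (N : Submodule k C) : Prop :=
  ∀ x ∈ N, Coalgebra.comul (R := k) x ∈ range (N.subtype.rTensor C)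

/-- A (right) chain coalgebra: its right coideals are linearly ordered by inclusion. -/
def IsChainCoalgebra : Prop :=
  ∀ N N' : Submodule k C, IsRightCoideal N → IsRightCoideal N' → N ≤ N' ∨ N' ≤ N

variable {k C} in
/-- Simple right coideals: the nonzero right coideals which contain no right coideals other than
`0` and themselves. -/
def IsSimpleRightCoideal (N : Submodule k C) : Prop :=
  IsRightCoideal N ∧ N ≠ ⊥ ∧ ∀ N' ≤ N, IsRightCoideal N' → N' = ⊥ ∨ N' = N

/-- The coradical `C₀`, the socle of `C` as a right comodule: the sum of all simple right
coideals. -/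
def coradical : Submodule k C := sSup {N | IsSimpleRightCoideal N}

variable {k C}

theorem isRightCoideal_sSup {S : Set (Submodule k C)} (h : ∀ N ∈ S, IsRightCoideal N) :
    IsRightCoideal (sSup S) := by
  intro x hx
  have : sSup S ≤ (range ((sSup S).subtype.rTensor C)).comap (Coalgebra.comul (R := k)) := by
    apply sSup_le
    intro N hN y hy
    obtain ⟨z, hz⟩ := h N hN y hy
    refine ⟨(Submodule.inclusion (le_sSup hN)).rTensor C z, ?_⟩
    rw [← rTensor_comp_apply, ← hz]
    rfl
  exact this hx

theorem mem_range_rTensor_iff {X V : Type*} [AddCommGroup X] [Module k X] [AddCommGroup V]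
    [Module k V] (p : Submodule k X) (z : X ⊗[k] V) :
    z ∈ range (p.subtype.rTensor V) ↔
      ∀ g : V →ₗ[k] k, TensorProduct.rid k X (g.lTensor X z) ∈ p := by
  constructor
  · rintro ⟨y, rfl⟩ g
    induction y with
    | zero => simp
    | add a b ha hb => simp only [map_add]; exact p.add_mem ha hb
    | tmul a b => simpa using p.smul_mem _ a.2
  · intro h
    let b := Module.Free.chooseBasis k V
    rw [← (TensorProduct.equivFinsuppOfBasisRight b).symm_apply_apply z,
      TensorProduct.equivFinsuppOfBasisRight_symm_apply]
    refine Submodule.sum_mem _ fun i _ => ?_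
    refine ⟨⟨_, h (b.coord i)⟩ ⊗ₜ b i, ?_⟩
    simp [TensorProduct.equivFinsuppOfBasisRight_apply]

theorem mem_range_lTensor_of {X V : Type*} [AddCommGroup X] [Module k X] [AddCommGroup V]
    [Module k V] (p : Submodule k X) (z : V ⊗[k] X)
    (h : ∀ g : V →ₗ[k] k, TensorProduct.lid k X (g.rTensor X z) ∈ p) :
    z ∈ range (p.subtype.lTensor V) := by
  let b := Module.Free.chooseBasis k V
  rw [← (TensorProduct.equivFinsuppOfBasisLeft b).symm_apply_apply z,
    TensorProduct.equivFinsuppOfBasisLeft_symm_apply]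
  refine Submodule.sum_mem _ fun i _ => ?_
  refine ⟨b i ⊗ₜ ⟨_, h (b.coord i)⟩, ?_⟩
  simp [TensorProduct.equivFinsuppOfBasisLeft_apply]

/-- The map `c ↦ ∑ g(c₁) c₂`. -/
def rightHit (g : C →ₗ[k] k) : C →ₗ[k] C :=
  (TensorProduct.lid k C).toLinearMap ∘ₗ g.rTensor C ∘ₗ Coalgebra.comul

theorem comul_rightHit (g : C →ₗ[k] k) (c : C) :
    Coalgebra.comul (R := k) (rightHit g c) =
      (rightHit g).rTensor C (Coalgebra.comul (R := k) c) := by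
  have h1 : Coalgebra.comul (R := k) ∘ₗ (TensorProduct.lid k C).toLinearMap ∘ₗ g.rTensor C =
      (TensorProduct.lid k (C ⊗[k] C)).toLinearMap ∘ₗ g.rTensor (C ⊗[k] C) ∘ₗ
        (Coalgebra.comul (R := k)).lTensor C := by
    ext; simp
  have h2 : (TensorProduct.lid k (C ⊗[k] C)).toLinearMap ∘ₗ g.rTensor (C ⊗[k] C) ∘ₗ
      (TensorProduct.assoc k C C C).toLinearMap =
      ((TensorProduct.lid k C).toLinearMap ∘ₗ g.rTensor C).rTensor C := by
    ext; simp [smul_tmul']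
  have h3 := LinearMap.congr_fun h1 (Coalgebra.comul (R := k) c)
  simp only [LinearMap.comp_apply, LinearEquiv.coe_coe] at h3
  have h4 := LinearMap.congr_fun h2
    ((Coalgebra.comul (R := k)).rTensor C (Coalgebra.comul (R := k) c))
  simp only [LinearMap.comp_apply, LinearEquiv.coe_coe] at h4
  simp only [rightHit, LinearMap.comp_apply, LinearEquiv.coe_coe]
  rw [h3, ← Coalgebra.coassoc_apply, h4, ← rTensor_comp_apply]
  rfl

theorem isRightCoideal_map (g : C →ₗ[k] k) {N : Submodule k C} (h : IsRightCoideal N) :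
    IsRightCoideal (N.map (rightHit g)) := by
  rintro _ ⟨y, hy, rfl⟩
  obtain ⟨z, hz⟩ := h y hy
  refine ⟨((rightHit g).submoduleMap N).rTensor C z, ?_⟩
  rw [comul_rightHit, ← hz, ← rTensor_comp_apply, ← rTensor_comp_apply]
  rfl

theorem isRightCoideal_comap (g : C →ₗ[k] k) {N N' : Submodule k C} (h : IsRightCoideal N)
    (h' : IsRightCoideal N') : IsRightCoideal (N ⊓ N'.comap (rightHit g)) := by
  intro x hx
  have h1 := h x hx.1
  have h2 := h' _ hx.2
  rw [mem_range_rTensor_iff] at h1 h2 ⊢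
  intro e
  refine ⟨h1 e, ?_⟩
  have h3 := h2 e
  rw [comul_rightHit, interchange] at h3
  have h4 : ∀ y : C ⊗[k] k, TensorProduct.rid k C ((rightHit g).rTensor k y) =
      rightHit g (TensorProduct.rid k C y) := by
    intro y
    have : (TensorProduct.rid k C).toLinearMap ∘ₗ (rightHit g).rTensor k =
        rightHit g ∘ₗ (TensorProduct.rid k C).toLinearMap := by
      ext; simp
    exact LinearMap.congr_fun this y
  rw [h4] at h3
  exact h3

theorem map_rightHit_simple (g : C →ₗ[k] k) {N : Submodule k C} (h : IsSimpleRightCoideal N) :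
    N.map (rightHit g) ≤ coradical k C := by
  by_cases h0 : N.map (rightHit g) = ⊥
  · rw [h0]; exact bot_le
  apply le_sSup
  refine ⟨isRightCoideal_map g h.1, h0, fun N' hN' hr => ?_⟩
  rcases h.2.2 _ inf_le_left (isRightCoideal_comap g h.1 hr) with hb | he
  · left
    rw [eq_bot_iff]
    intro x hx
    obtain ⟨y, hy, rfl⟩ := hN' hx
    have : y ∈ (⊥ : Submodule k C) := hb ▸ ⟨hy, hx⟩
    rw [Submodule.mem_bot] at this
    simp [this]
  · right
    apply le_antisymm hN'
    rintro _ ⟨y, hy, rfl⟩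
    rw [← he] at hy
    exact hy.2

theorem rightHit_mem_coradical (g : C →ₗ[k] k) {x : C} (hx : x ∈ coradical k C) :
    rightHit g x ∈ coradical k C := by
  have : coradical k C ≤ (coradical k C).comap (rightHit g) := by
    apply sSup_le
    intro N hN
    exact Submodule.map_le_iff_le_comap.1 (map_rightHit_simple g hN)
  exact this hx

/-- Subcoalgebras of `C`: subspaces `N` with `Δ(N) ⊆ N ⊗ N`. -/
def IsSubcoalgebra (N : Submodule k C) : Prop :=
  ∀ x ∈ N, Coalgebra.comul (R := k) x ∈ range (TensorProduct.map N.subtype N.subtype)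

theorem isRightCoideal_coradical : IsRightCoideal (coradical k C) :=
  isRightCoideal_sSup fun _ hN => hN.1

/-- The coradical is a subcoalgebra. -/
theorem isSubcoalgebra_coradical : IsSubcoalgebra (coradical k C) := by
  intro x hx
  obtain ⟨y, hy⟩ := isRightCoideal_coradical x hx
  have h1 : y ∈ range ((coradical k C).subtype.lTensor (coradical k C)) := by
    apply mem_range_lTensor_of
    intro g
    obtain ⟨g', hg'⟩ := g.exists_extend
    rw [← hg', rTensor_comp_apply]
    have h2 := rightHit_mem_coradical g' hx
    rw [rightHit, LinearMap.comp_apply, LinearMap.comp_apply, ← hy] at h2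
    exact h2
  obtain ⟨w, rfl⟩ := h1
  refine ⟨w, ?_⟩
  rw [map_eq_rTensor_lTensor]
  exact hy

/-- The comultiplication of a subcoalgebra. -/
def subComul {N : Submodule k C} (h : IsSubcoalgebra N) : N →ₗ[k] N ⊗[k] N :=
  factor (TensorProduct.map N.subtype N.subtype) (map_subtype_injective N)
    (Coalgebra.comul ∘ₗ N.subtype) (fun z => h z.1 z.2)

theorem subComul_apply {N : Submodule k C} (h : IsSubcoalgebra N) (x : N) :
    TensorProduct.map N.subtype N.subtype (subComul h x) = Coalgebra.comul (R := k) x.1 :=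
  factor_apply _ _ _ _ x

/-- A subcoalgebra as a coalgebra, with the restricted comultiplication and counit. -/
abbrev subCoalgebra {N : Submodule k C} (h : IsSubcoalgebra N) : Coalgebra k N where
  comul := subComul h
  counit := Coalgebra.counit ∘ₗ N.subtype
  coassoc := by
    have hc : TensorProduct.map N.subtype N.subtype ∘ₗ subComul h =
      Coalgebra.comul ∘ₗ N.subtype := LinearMap.ext (subComul_apply h)
    ext1 x
    have hinj : Function.Injective
        (TensorProduct.map N.subtype (TensorProduct.map N.subtype N.subtype)) := by
      rw [← LinearMap.rTensor_comp_lTensor, LinearMap.coe_comp]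
      exact (rTensor_subtype_injective (C ⊗[k] C) N).comp
        (Module.Flat.lTensor_preserves_injective_linearMap _ (map_subtype_injective N))
    apply hinj
    rw [LinearMap.comp_apply, LinearMap.comp_apply, LinearMap.comp_apply, LinearEquiv.coe_coe,
      ← map_map_assoc, ← map_comp_left, ← map_comp_right, hc, ← rTensor_map, ← lTensor_map,
      subComul_apply, Coalgebra.coassoc_apply]
  rTensor_counit_comp_comul := by
    ext1 x
    apply lTensor_subtype_injective k N
    rw [LinearMap.comp_apply, rTensor_comp_apply, interchange, interchange,
      ← map_eq_rTensor_lTensor, subComul_apply, Coalgebra.rTensor_counit_comul]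
    simp
  lTensor_counit_comp_comul := by
    ext1 x
    apply rTensor_subtype_injective k N
    rw [LinearMap.comp_apply, lTensor_comp_apply, ← interchange, ← interchange,
      ← map_eq_lTensor_rTensor, subComul_apply, Coalgebra.lTensor_counit_comul]
    simp

/-- The coradical as a coalgebra. -/
instance : Coalgebra k (coradical k C) := subCoalgebra isSubcoalgebra_coradical

variable (k C)

/-- A chain coalgebra of type `D`: a chain coalgebra `C` such that the algebra `(C₀)*` dual to the
coradical `C₀`, with the convolution product, is isomorphic to `D`. -/
def IsChainCoalgebraOfType (D : Type*) [Ring D] [Algebra k D] : Prop :=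
  IsChainCoalgebra k C ∧ Nonempty (WithConv (coradical k C →ₗ[k] k) ≃ₐ[k] D)

end Chain

/-- Separable algebras: the multiplication `D ⊗ D → D` is split by a map of `D`-bimodules; the
image `e` of `1` under such a splitting is an element with `μ(e) = 1` and `a e = e a` for all
`a ∈ D`. -/
def IsSeparableAlgebra (k D : Type*) [Field k] [Ring D] [Algebra k D] : Prop :=
  ∃ e : D ⊗[k] D, LinearMap.mul' k D e = 1 ∧
    ∀ a : D, (LinearMap.mulLeft k a).rTensor D e = (LinearMap.mulRight k a).lTensor D e

end ChainCoalg

end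

universe u v w t

/-!
Right coideals of a coalgebra are its subspaces stable under the left action
`g ↦ (c ↦ ∑ c₁ g(c₂))` of the dual algebra.

For the first part, filter `T = T_{D*}(M*)` by degree. Acting by a suitable functional of degree one
lowers the degree of any element of positive degree by exactly one, so a right coideal containing an
element of degree `n` contains elements of every lower degree. Through the degree zero functionals
it is stable under `D`. Slicing off the first factor with evaluation at a nonzero vector of `M` is
injective on cotensor products, so every homogeneous component has dimension at most `dim D`, and it
is exhausted by the `D`-orbit of any of its nonzero elements. Hence the proper right coideals are
the terms of the filtration.

For the second part, let `J` be the ideal of functionals on `C` which vanish on `C₀`, and `J₂` the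
ideal of those which vanish on `C₁`. Since right coideals are linearly ordered, the coradical
filtration is exhaustive, so the dual algebra `A` of `C` is complete for the orthogonal filtration,
and separability lets a linear section of `A → A / J ≅ D` be corrected to an algebra map
`s : D → A`. No right coideal lies strictly between `C₀` and `C₁`, so `J = j s(D) + J₂` for any `j`
in `J` outside `J₂`. This gives an endomorphism `τ` of `D` with `s(d) j ≡ j s(τ d)` modulo `J₂`, and
averaging `j` over a separability idempotent yields `m ≡ j` with `s(d) m = m s(τ d)` exactly. The
transposes of `s` and `d ↦ m s(d)` induce a coalgebra map from `C` to the cotensor coalgebra of `D`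
twisted by `τ`. It is injective because the image of its dual map, a subalgebra, contains `s(D)` and
`m s(D)`, which span `A` modulo `J₂`.
-/

noncomputable section

namespace ChainCoalg

open TensorProduct LinearMap WithConv Module Bicomodule

/-! ### Dual algebras and the coradical filtration -/

section Slice

variable {k V W V' W' : Type*} [CommSemiring k] [AddCommMonoid V] [Module k V] [AddCommMonoid W]
  [Module k W] [AddCommMonoid V'] [Module k V'] [AddCommMonoid W'] [Module k W']

variable (W) in
/-- The slice map `v ⊗ w ↦ g v • w` of a functional `g`. -/
def leftSlice (g : V →ₗ[k] k) : V ⊗[k] W →ₗ[k] W :=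
  (TensorProduct.lid k W).toLinearMap ∘ₗ g.rTensor W

variable (V) in
/-- The slice map `v ⊗ w ↦ g w • v` of a functional `g`. -/
def rightSlice (g : W →ₗ[k] k) : V ⊗[k] W →ₗ[k] V :=
  (TensorProduct.rid k V).toLinearMap ∘ₗ g.lTensor V

@[simp] theorem leftSlice_tmul (g : V →ₗ[k] k) (v : V) (w : W) :
    leftSlice W g (v ⊗ₜ w) = g v • w := by
  simp [leftSlice]

@[simp] theorem rightSlice_tmul (g : W →ₗ[k] k) (v : V) (w : W) :
    rightSlice V g (v ⊗ₜ w) = g w • v := by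
  simp [rightSlice]

theorem leftSlice_map (g : V' →ₗ[k] k) (f : V →ₗ[k] V') (h : W →ₗ[k] W') (z : V ⊗[k] W) :
    leftSlice W' g (TensorProduct.map f h z) = h (leftSlice W (g ∘ₗ f) z) := by
  induction z with
  | zero => simp
  | add x y hx hy => simp [hx, hy]
  | tmul x y => simp

theorem rightSlice_map (g : W' →ₗ[k] k) (f : V →ₗ[k] V') (h : W →ₗ[k] W') (z : V ⊗[k] W) :
    rightSlice V' g (TensorProduct.map f h z) = f (rightSlice V (g ∘ₗ h) z) := by
  induction z with
  | zero => simp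
  | add x y hx hy => simp [hx, hy]
  | tmul x y => simp

theorem leftSlice_lTensor (g : V →ₗ[k] k) (h : W →ₗ[k] W') (z : V ⊗[k] W) :
    leftSlice W' g (h.lTensor V z) = h (leftSlice W g z) :=
  leftSlice_map g LinearMap.id h z

theorem rightSlice_rTensor (g : W →ₗ[k] k) (f : V →ₗ[k] V') (z : V ⊗[k] W) :
    rightSlice V' g (f.rTensor W z) = f (rightSlice V g z) :=
  rightSlice_map g f LinearMap.id z

theorem rightSlice_comp (g : W' →ₗ[k] k) (h : W →ₗ[k] W') (z : V ⊗[k] W) :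
    rightSlice V (g ∘ₗ h) z = rightSlice V g (h.lTensor V z) :=
  (rightSlice_map g LinearMap.id h z).symm

theorem apply_leftSlice (g : V →ₗ[k] k) (f : W →ₗ[k] k) (z : V ⊗[k] W) :
    f (leftSlice W g z) = mul' k k (TensorProduct.map g f z) := by
  induction z with
  | zero => simp
  | add x y hx hy => simp [hx, hy]
  | tmul x y => simp

theorem apply_rightSlice (g : W →ₗ[k] k) (f : V →ₗ[k] k) (z : V ⊗[k] W) :
    f (rightSlice V g z) = mul' k k (TensorProduct.map f g z) := by
  induction z with
  | zero => simp
  | add x y hx hy => simp [hx, hy]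
  | tmul x y => simp [mul_comm]

end Slice

section DualAlgebra

variable {k C E : Type*} [Field k] [AddCommGroup C] [Module k C] [Coalgebra k C]
  [AddCommGroup E] [Module k E] [Coalgebra k E]

theorem eq_of_forall_functional {V : Type*} [AddCommGroup V] [Module k V] {x y : V}
    (h : ∀ f : V →ₗ[k] k, f x = f y) : x = y := by
  rw [← sub_eq_zero, ← forall_dual_apply_eq_zero_iff k]
  exact fun f => by rw [map_sub, h f, sub_self]

variable (k C) in
/-- The algebra dual to a coalgebra, with the convolution product. -/
abbrev DualAlgebra := WithConv (C →ₗ[k] k)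

theorem mul_apply_rightHit (a b : DualAlgebra k C) (c : C) :
    (a * b) c = b (rightHit a.ofConv c) :=
  (apply_leftSlice a.ofConv b.ofConv (Coalgebra.comul c)).symm

/-- The left action `c ↦ ∑ c₁ g(c₂)` of the dual algebra; the stable subspaces are the right
coideals. -/
def leftHit (g : DualAlgebra k C) : C →ₗ[k] C := rightSlice C g.ofConv ∘ₗ Coalgebra.comul

theorem mul_apply_leftHit (a b : DualAlgebra k C) (c : C) : (a * b) c = a (leftHit b c) :=
  (apply_rightSlice b.ofConv a.ofConv (Coalgebra.comul c)).symm

theorem leftHit_one (c : C) : leftHit (1 : DualAlgebra k C) c = c :=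
  eq_of_forall_functional (k := k) fun f => by
    rw [← mul_apply_leftHit (toConv f), mul_one]

theorem leftHit_mul (a b : DualAlgebra k C) (c : C) :
    leftHit (a * b) c = leftHit a (leftHit b c) :=
  eq_of_forall_functional fun f => by
    have h := mul_apply_leftHit (toConv f) (a * b) c
    rw [← mul_assoc, mul_apply_leftHit, mul_apply_leftHit] at h
    exact h.symm

theorem leftHit_rightHit (a b : DualAlgebra k C) (c : C) :
    leftHit a (rightHit b.ofConv c) = rightHit b.ofConv (leftHit a c) :=
  eq_of_forall_functional fun f => by
    have h := mul_apply_rightHit b (toConv f * a) c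
    rw [← mul_assoc, mul_apply_leftHit, mul_apply_rightHit, mul_apply_leftHit] at h
    exact h.symm

theorem isRightCoideal_iff {N : Submodule k C} :
    IsRightCoideal N ↔ ∀ x ∈ N, ∀ g : DualAlgebra k C, leftHit g x ∈ N :=
  forall₂_congr fun _ _ => (mem_range_rTensor_iff _ _).trans
    ⟨fun h g => h g.ofConv, fun h g => h (toConv g)⟩

/-- The algebra map `a ↦ a ∘ φ` dual to a coalgebra map `φ`. -/
def dualMap (φ : C →ₗc[k] E) : DualAlgebra k E →ₐ[k] DualAlgebra k C :=
  AlgHom.ofLinearMap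
    { toFun := fun a => toConv (a.ofConv ∘ₗ φ.toLinearMap)
      map_add' := fun _ _ => rfl
      map_smul' := fun _ _ => rfl }
    (WithConv.ext φ.counit_comp)
    (fun a b => WithConv.ext (convMul_comp_coalgHom_distrib a b φ))

@[simp] theorem dualMap_apply (φ : C →ₗc[k] E) (a : DualAlgebra k E) (c : C) :
    dualMap φ a c = a (φ c) := rfl

theorem dualMap_surjective {φ : C →ₗc[k] E} (h : Function.Injective φ) :
    Function.Surjective (dualMap φ) := fun a => by
  obtain ⟨f, hf⟩ := LinearMap.dualMap_surjective_of_injective (f := φ.toLinearMap) h a.ofConv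
  exact ⟨toConv f, WithConv.ext hf⟩

theorem dualMap_injective {φ : C →ₗc[k] E} (h : Function.Surjective φ) :
    Function.Injective (dualMap φ) := fun a b hab =>
  WithConv.ext (LinearMap.ext fun x => by
    obtain ⟨c, rfl⟩ := h x
    exact LinearMap.congr_fun (congrArg ofConv hab) c)

end DualAlgebra

section CyclicCoideal

variable {k C : Type*} [Field k] [AddCommGroup C] [Module k C] [Coalgebra k C]

/-- The map `g ↦ ∑ c₁ g(c₂)` from the dual algebra. -/
def leftOrbit (c : C) : DualAlgebra k C →ₗ[k] C where
  toFun g := leftHit g c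
  map_add' f g := by simp [leftHit, rightSlice, lTensor_add]
  map_smul' r g := by simp [leftHit, rightSlice, lTensor_smul]

/-- The right coideal generated by an element. -/
def cyclicCoideal (c : C) : Submodule k C := range (leftOrbit (k := k) c)

theorem mem_cyclicCoideal {c x : C} :
    x ∈ cyclicCoideal (k := k) c ↔ ∃ g : DualAlgebra k C, leftHit g c = x := Iff.rfl

theorem self_mem_cyclicCoideal (c : C) : c ∈ cyclicCoideal (k := k) c :=
  mem_cyclicCoideal.2 ⟨1, leftHit_one c⟩

theorem isRightCoideal_cyclicCoideal (c : C) : IsRightCoideal (cyclicCoideal (k := k) c) := by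
  rw [isRightCoideal_iff]
  rintro _ ⟨g, rfl⟩ f
  exact ⟨f * g, leftHit_mul f g c⟩

theorem cyclicCoideal_le_iff {c : C} {N : Submodule k C} (h : IsRightCoideal N) :
    cyclicCoideal c ≤ N ↔ c ∈ N := by
  refine ⟨fun hc => hc (self_mem_cyclicCoideal c), ?_⟩
  rintro hc _ ⟨g, rfl⟩
  exact isRightCoideal_iff.1 h c hc g

theorem cyclicCoideal_eq_bot_iff {c : C} : cyclicCoideal (k := k) c = ⊥ ↔ c = 0 := by
  have hbot : IsRightCoideal (⊥ : Submodule k C) := isRightCoideal_iff.2 fun x hx g => by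
    rw [(Submodule.mem_bot k).1 hx, map_zero]
    exact zero_mem _
  rw [eq_bot_iff, cyclicCoideal_le_iff hbot, Submodule.mem_bot]

theorem cyclicCoideal_rightHit (g : C →ₗ[k] k) (c : C) :
    cyclicCoideal (rightHit g c) = (cyclicCoideal c).map (rightHit g) := by
  apply le_antisymm
  · rw [cyclicCoideal_le_iff (isRightCoideal_map _ (isRightCoideal_cyclicCoideal c))]
    exact ⟨c, self_mem_cyclicCoideal c, rfl⟩
  · rintro _ ⟨_, ⟨f, rfl⟩, rfl⟩
    exact ⟨f, leftHit_rightHit f (toConv g) c⟩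

instance finiteDimensional_cyclicCoideal (c : C) :
    FiniteDimensional k (cyclicCoideal (k := k) c) := by
  obtain ⟨n, x, y, hxy⟩ := TensorProduct.exists_sum_tmul_eq (Coalgebra.comul (R := k) c)
  have := FiniteDimensional.span_of_finite k (Set.finite_range x)
  refine Submodule.finiteDimensional_of_le (S₂ := Submodule.span k (Set.range x)) ?_
  rintro _ ⟨g, rfl⟩
  change rightSlice C g.ofConv (Coalgebra.comul c) ∈ _
  rw [hxy, map_sum]
  refine sum_mem fun i _ => ?_
  rw [rightSlice_tmul]
  exact Submodule.smul_mem _ _ (Submodule.subset_span ⟨i, rfl⟩)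

end CyclicCoideal

section Orthogonality

variable {k C : Type*} [Field k] [AddCommGroup C] [Module k C]

theorem mem_iff_forall_dualAlgebra {N : Submodule k C} {c : C} :
    c ∈ N ↔ ∀ a : DualAlgebra k C, (∀ x ∈ N, a x = 0) → a c = 0 := by
  rw [← Subspace.forall_mem_dualAnnihilator_apply_eq_zero_iff]
  refine ⟨fun h a ha => h a.ofConv ?_, fun h f hf => h (toConv f) ?_⟩
  · exact (Submodule.mem_dualAnnihilator _).2 ha
  · exact (Submodule.mem_dualAnnihilator _).1 hf

variable [Coalgebra k C]

theorem rightHit_eq_zero {N : Submodule k C} (hN : IsRightCoideal N) {a : DualAlgebra k C}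
    (ha : ∀ c ∈ N, a c = 0) {c : C} (hc : c ∈ N) : rightHit a.ofConv c = 0 :=
  eq_of_forall_functional fun f => by
    have h := mul_apply_leftHit a (toConv f) c
    rw [ha _ (isRightCoideal_iff.1 hN c hc _), mul_apply_rightHit, ← map_zero f] at h
    exact h

end Orthogonality

section Coradical

variable {k C : Type*} [Field k] [AddCommGroup C] [Module k C] [Coalgebra k C]

theorem coradical_eq_of_forall_le {S : Submodule k C} (hS : IsRightCoideal S) (hS0 : S ≠ ⊥)
    (hle : ∀ N : Submodule k C, IsRightCoideal N → N ≠ ⊥ → S ≤ N) : coradical k C = S := by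
  apply le_antisymm
  · refine sSup_le fun N hN => ?_
    rcases hN.2.2 S (hle N hN.1 hN.2.1) hS with h | h
    · exact absurd h hS0
    · exact h.ge
  · refine le_sSup ⟨hS, hS0, fun N hN hNc => ?_⟩
    exact or_iff_not_imp_left.2 fun h => le_antisymm hN (hle N hNc h)

theorem IsChainCoalgebra.coradical_le (h : IsChainCoalgebra k C) (h0 : coradical k C ≠ ⊥)
    {N : Submodule k C} (hN : IsRightCoideal N) (hN0 : N ≠ ⊥) : coradical k C ≤ N := by
  obtain ⟨S, hS⟩ : ∃ S : Submodule k C, IsSimpleRightCoideal S := by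
    by_contra! hn
    exact h0 (eq_bot_iff.2 (sSup_le fun S hS => absurd hS (hn S)))
  have hle : ∀ N : Submodule k C, IsRightCoideal N → N ≠ ⊥ → S ≤ N := fun N hN hN0 =>
    (h S N hS.1 hN).elim id fun hNS => ((hS.2.2 N hNS hN).resolve_left hN0).ge
  rw [coradical_eq_of_forall_le hS.1 hS.2.1 hle]
  exact hle N hN hN0

variable (k C) in
/-- The inclusion of the coradical, as a coalgebra map. -/
def coradicalInclusion : coradical k C →ₗc[k] C where
  __ := (coradical k C).subtype
  counit_comp := rfl
  map_comp_comul := LinearMap.ext fun x => subComul_apply isSubcoalgebra_coradical x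

variable (k C) in
/-- The functionals which vanish on the coradical. -/
def coradicalIdeal : Ideal (DualAlgebra k C) := RingHom.ker (dualMap (coradicalInclusion k C))

instance : (coradicalIdeal k C).IsTwoSided := inferInstanceAs (RingHom.ker _).IsTwoSided

theorem mem_coradicalIdeal {a : DualAlgebra k C} :
    a ∈ coradicalIdeal k C ↔ ∀ c ∈ coradical k C, a c = 0 := by
  refine ⟨fun h c hc => LinearMap.congr_fun (congrArg ofConv h) ⟨c, hc⟩, fun h => ?_⟩
  exact WithConv.ext (LinearMap.ext fun x => h x.1 x.2)

theorem coradical_ne_bot [Nontrivial (DualAlgebra k (coradical k C))] : coradical k C ≠ ⊥ := by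
  intro h
  have : Subsingleton (coradical k C) := h ▸ inferInstance
  exact not_subsingleton (DualAlgebra k (coradical k C))
    ⟨fun a b => WithConv.ext (Subsingleton.elim _ _)⟩

end Coradical

section CoradicalFiltration

variable {k C : Type*} [Field k] [AddCommGroup C] [Module k C] [Coalgebra k C]

variable (k C) in
/-- The coradical filtration `0 ⊆ C₀ ⊆ C₁ ⊆ ⋯`, indexed so that the `n`-th term is orthogonal to
the `n`-th power of the ideal of functionals which vanish on `C₀`. -/
def coradicalFiltration (n : ℕ) : Submodule k C :=
  ⨅ a : ↥(coradicalIdeal k C ^ n), ker a.1.ofConv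

theorem mem_coradicalFiltration {n : ℕ} {c : C} :
    c ∈ coradicalFiltration k C n ↔ ∀ a ∈ coradicalIdeal k C ^ n, a c = 0 := by
  simp [coradicalFiltration, Submodule.mem_iInf]

@[simp] theorem coradicalFiltration_zero : coradicalFiltration k C 0 = ⊥ := by
  refine eq_bot_iff.2 fun c hc => eq_of_forall_functional (k := k) fun f => ?_
  rw [map_zero]
  exact mem_coradicalFiltration.1 hc (toConv f) (by simp [Submodule.pow_zero])

theorem coradicalFiltration_one : coradicalFiltration k C 1 = coradical k C := by
  ext c
  rw [mem_coradicalFiltration, Submodule.pow_one, mem_iff_forall_dualAlgebra]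
  simp only [mem_coradicalIdeal]

theorem mem_coradicalFiltration_succ {n : ℕ} {c : C} : c ∈ coradicalFiltration k C (n + 1) ↔
    ∀ a ∈ coradicalIdeal k C, rightHit a.ofConv c ∈ coradicalFiltration k C n := by
  simp only [mem_coradicalFiltration, ← mul_apply_rightHit]
  rw [Ideal.IsTwoSided.pow_succ]
  refine ⟨fun h a ha b hb => h _ (Ideal.mul_mem_mul ha hb), fun h a ha => ?_⟩
  induction ha using Submodule.smul_induction_on' with
  | smul a ha b hb => exact h a ha b hb
  | add a _ b _ hac hbc => exact (congrArg₂ (· + ·) hac hbc).trans (add_zero 0)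

theorem isRightCoideal_coradicalFiltration (n : ℕ) : IsRightCoideal (coradicalFiltration k C n) :=
  isRightCoideal_iff.2 fun c hc g => mem_coradicalFiltration.2 fun a ha => by
    rw [← mul_apply_leftHit]
    exact mem_coradicalFiltration.1 hc _ (Ideal.mul_mem_right g _ ha)

theorem coradicalFiltration_mono : Monotone (coradicalFiltration k C) := fun _ _ h _ hc =>
  mem_coradicalFiltration.2 fun a ha => mem_coradicalFiltration.1 hc a (Ideal.pow_le_pow_right h ha)

variable (k C) in
/-- The filtration of the dual algebra by the functionals which vanish on the terms of the
coradical filtration. -/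
def dualFiltration (n : ℕ) : Ideal (DualAlgebra k C) where
  carrier := {a | ∀ c ∈ coradicalFiltration k C n, a c = 0}
  add_mem' ha hb c hc := (congrArg₂ (· + ·) (ha c hc) (hb c hc)).trans (add_zero 0)
  zero_mem' _ _ := rfl
  smul_mem' a b hb c hc := (mul_apply_rightHit a b c).trans <|
    hb _ <| mem_coradicalFiltration.2 fun y hy => by
      rw [← mul_apply_rightHit]
      exact mem_coradicalFiltration.1 hc _ (Ideal.mul_mem_left _ a hy)

theorem mem_dualFiltration {n : ℕ} {a : DualAlgebra k C} :
    a ∈ dualFiltration k C n ↔ ∀ c ∈ coradicalFiltration k C n, a c = 0 := Iff.rfl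

instance (n : ℕ) : (dualFiltration k C n).IsTwoSided where
  mul_mem_of_left b ha c hc := (mul_apply_leftHit _ b c).trans <|
    ha _ <| isRightCoideal_iff.1 (isRightCoideal_coradicalFiltration n) c hc b

theorem dualFiltration_zero : dualFiltration k C 0 = ⊤ :=
  eq_top_iff.2 fun a _ => mem_dualFiltration.2 (by simp)

theorem dualFiltration_one : dualFiltration k C 1 = coradicalIdeal k C := by
  ext a
  rw [mem_dualFiltration, mem_coradicalIdeal, coradicalFiltration_one]

theorem dualFiltration_antitone : Antitone (dualFiltration k C) := fun _ _ h _ ha c hc =>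
  ha c (coradicalFiltration_mono h hc)

theorem mul_mem_dualFiltration {m n : ℕ} {a b : DualAlgebra k C}
    (ha : a ∈ dualFiltration k C m) (hb : b ∈ dualFiltration k C n) :
    a * b ∈ dualFiltration k C (m + n) := by
  intro c hc
  rw [mul_apply_rightHit]
  refine hb _ (mem_coradicalFiltration.2 fun y hy => ?_)
  rw [← mul_apply_rightHit, mul_apply_leftHit]
  refine ha _ (mem_coradicalFiltration.2 fun x hx => ?_)
  rw [← mul_apply_leftHit]
  refine mem_coradicalFiltration.1 hc _ ?_
  rw [Ideal.IsTwoSided.pow_add]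
  exact Ideal.mul_mem_mul hx hy

theorem rightHit_mem_coradicalFiltration {m n : ℕ} {a : DualAlgebra k C}
    (ha : a ∈ dualFiltration k C m) {c : C} (hc : c ∈ coradicalFiltration k C (m + n)) :
    rightHit a.ofConv c ∈ coradicalFiltration k C n :=
  mem_coradicalFiltration.2 fun b hb => by
    rw [← mul_apply_rightHit]
    exact mul_mem_dualFiltration ha (fun x hx => mem_coradicalFiltration.1 hx b hb) c hc

/-- The annihilator of the coradical in a cyclic coideal is nonzero, so acting by the coradical
ideal lowers the dimension of the cyclic coideal. -/
theorem IsChainCoalgebra.mem_coradicalFiltration_finrank (h : IsChainCoalgebra k C)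
    (h0 : coradical k C ≠ ⊥) {d : ℕ} {c : C}
    (hd : finrank k (cyclicCoideal (k := k) c) ≤ d) : c ∈ coradicalFiltration k C d := by
  induction d generalizing c with
  | zero =>
    rw [cyclicCoideal_eq_bot_iff.1 (Submodule.finrank_eq_zero.1 (Nat.le_zero.1 hd))]
    exact zero_mem _
  | succ d ih =>
    refine mem_coradicalFiltration_succ.2 fun a ha => ?_
    rcases eq_or_ne c 0 with rfl | hc
    · rw [map_zero]
      exact zero_mem _
    have hle : coradical k C ≤ cyclicCoideal c :=
      h.coradical_le h0 (isRightCoideal_cyclicCoideal c) (cyclicCoideal_eq_bot_iff.not.2 hc)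
    obtain ⟨x, hx, hx0⟩ := Submodule.exists_mem_ne_zero_of_ne_bot h0
    let ρ := (rightHit a.ofConv).domRestrict (cyclicCoideal c)
    have hker : 0 < finrank k (ker ρ) := by
      refine finrank_pos_iff_exists_ne_zero.2 ⟨⟨⟨x, hle hx⟩, ?_⟩, fun hn => hx0 ?_⟩
      · exact rightHit_eq_zero isRightCoideal_coradical (mem_coradicalIdeal.1 ha) hx
      · exact congrArg (fun z => z.1.1) hn
    have hrank := finrank_range_add_finrank_ker ρ
    refine ih ?_
    rw [cyclicCoideal_rightHit, ← LinearMap.range_domRestrict]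
    change finrank k (range ρ) ≤ d
    omega

theorem IsChainCoalgebra.exists_mem_coradicalFiltration (h : IsChainCoalgebra k C)
    (h0 : coradical k C ≠ ⊥) (c : C) : ∃ n, c ∈ coradicalFiltration k C n :=
  ⟨_, h.mem_coradicalFiltration_finrank h0 le_rfl⟩

theorem IsChainCoalgebra.le_coradical_of_lt (h : IsChainCoalgebra k C) (h0 : coradical k C ≠ ⊥)
    {N : Submodule k C} (hN : IsRightCoideal N) (hlt : N < coradicalFiltration k C 2) :
    N ≤ coradical k C := by
  intro y hy
  rw [← coradicalFiltration_one, mem_coradicalFiltration_succ]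
  intro a ha
  by_contra hne
  obtain ⟨c, hc, hcN⟩ := SetLike.exists_of_lt hlt
  refine hcN ?_
  -- `c` and some `g`-translate of `y` have the same image under `a`, and the kernel of `a` on `C₁`
  -- does not contain `y`, so it is contained in `N`.
  have hac : rightHit a.ofConv c ∈ coradical k C := by
    rw [← coradicalFiltration_one]
    exact mem_coradicalFiltration_succ.1 hc a ha
  have hy_ne : cyclicCoideal (k := k) (rightHit a.ofConv y) ≠ ⊥ := fun hbot =>
    hne (by rw [cyclicCoideal_eq_bot_iff.1 hbot]; exact zero_mem _)
  obtain ⟨g, hg⟩ := h.coradical_le h0 (isRightCoideal_cyclicCoideal _) hy_ne hac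
  have hgy : leftHit g y ∈ N := isRightCoideal_iff.1 hN y hy g
  have hker : rightHit a.ofConv (c - leftHit g y) = 0 := by
    rw [map_sub, ← leftHit_rightHit, sub_eq_zero]
    exact hg.symm
  have hK : IsRightCoideal
      (coradicalFiltration k C 2 ⊓ (coradicalFiltration k C 0).comap (rightHit a.ofConv)) :=
    isRightCoideal_comap _ (isRightCoideal_coradicalFiltration 2)
      (isRightCoideal_coradicalFiltration 0)
  have hKN : coradicalFiltration k C 2 ⊓ (coradicalFiltration k C 0).comap (rightHit a.ofConv) ≤
      N := by
    rcases h _ _ hK (isRightCoideal_cyclicCoideal y) with hle | hle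
    · exact hle.trans ((cyclicCoideal_le_iff hN).2 hy)
    · exact absurd (hle (self_mem_cyclicCoideal y)).2 hne
  have hdiff : c - leftHit g y ∈ N := hKN ⟨sub_mem hc (hlt.le hgy), by simp [hker]⟩
  simpa using add_mem hdiff hgy

end CoradicalFiltration

/-! ### Separability and complete filtrations -/

section Separability

variable {k D A : Type*} [Field k] [Ring D] [Algebra k D] [Ring A] [Algebra k A]
  {ι : Type*} [Fintype ι] {x y : ι → D}

variable (k) in
/-- The components of a separability idempotent `∑ xᵢ ⊗ yᵢ`. -/
structure IsSeparabilitySystem (x y : ι → D) : Prop where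
  sum_mul_eq_one : ∑ i, x i * y i = 1
  sum_tmul_comm : ∀ a : D, ∑ i, (a * x i) ⊗ₜ[k] y i = ∑ i, x i ⊗ₜ[k] (y i * a)

theorem IsSeparableAlgebra.exists_isSeparabilitySystem (h : IsSeparableAlgebra k D) :
    ∃ (n : ℕ) (x y : Fin n → D), IsSeparabilitySystem k x y := by
  obtain ⟨e, hmul, hcomm⟩ := h
  obtain ⟨n, x, y, rfl⟩ := TensorProduct.exists_sum_tmul_eq e
  exact ⟨n, x, y, by simpa using hmul, fun a => by simpa using hcomm a⟩

namespace IsSeparabilitySystem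

variable (hxy : IsSeparabilitySystem k x y)
include hxy

theorem sum_apply_comm {V : Type*} [AddCommGroup V] [Module k V] (B : D →ₗ[k] D →ₗ[k] V) (a : D) :
    ∑ i, B (a * x i) (y i) = ∑ i, B (x i) (y i * a) := by
  simpa using congrArg (TensorProduct.lift B) (hxy.sum_tmul_comm a)

theorem average_comm (s t : D →ₐ[k] A) (j : A) (a : D) :
    s a * ∑ i, s (x i) * j * t (y i) = (∑ i, s (x i) * j * t (y i)) * t a := by
  have h := hxy.sum_apply_comm ((LinearMap.mul k A).compl₁₂
    (LinearMap.mulRight k j ∘ₗ s.toLinearMap) t.toLinearMap) a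
  simp only [compl₁₂_apply, comp_apply, AlgHom.toLinearMap_apply, mulRight_apply, mul_apply',
    map_mul] at h
  rw [Finset.mul_sum, Finset.sum_mul]
  simpa only [mul_assoc] using h

theorem average_sub_mem (s t : D →ₐ[k] A) (j : A) {I : Ideal A} [I.IsTwoSided]
    (h : ∀ d, s d * j - j * t d ∈ I) : ∑ i, s (x i) * j * t (y i) - j ∈ I := by
  have hj : j = ∑ i, j * t (x i) * t (y i) := by
    simp only [mul_assoc, ← map_mul, ← Finset.mul_sum, ← map_sum]
    rw [hxy.sum_mul_eq_one, map_one, mul_one]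
  have hsub : ∑ i, s (x i) * j * t (y i) - j = ∑ i, (s (x i) * j - j * t (x i)) * t (y i) := by
    conv_lhs => rw [hj]
    simp only [sub_mul, Finset.sum_sub_distrib, ← hj]
  rw [hsub]
  exact sum_mem fun i _ => I.mul_mem_right _ (h _)

end IsSeparabilitySystem

end Separability

section Lifting

variable {k D A : Type*} [Field k] [Ring D] [Algebra k D] [Ring A] [Algebra k A]
  {ι : Type*} [Fintype ι] {x y : ι → D} {s : D →ₗ[k] A} {I : ℕ → Ideal A}

/-- The failure of a linear map to be multiplicative. -/
def multDefect (s : D →ₗ[k] A) : D →ₗ[k] D →ₗ[k] A :=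
  (LinearMap.mul k A).compl₁₂ s s - (LinearMap.mul k D).compr₂ s

@[simp] theorem multDefect_apply (s : D →ₗ[k] A) (a b : D) :
    multDefect s a b = s a * s b - s (a * b) := by
  simp [multDefect]

/-- The correction to a linear map `s` which turns a multiplicative defect of order `n` into one of
order `2n`. The defect is a Hochschild cocycle up to higher order; a separability system provides
the contracting homotopy which writes it as a coboundary. -/
def multCorrection (x y : ι → D) (s : D →ₗ[k] A) : D →ₗ[k] A :=
  ∑ i, LinearMap.mulLeft k (s (x i)) ∘ₗ multDefect s (y i)

theorem multCorrection_apply (s : D →ₗ[k] A) (a : D) :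
    multCorrection x y s a = ∑ i, s (x i) * multDefect s (y i) a := by
  simp [multCorrection, LinearMap.sum_apply]

theorem multCorrection_one (hs : s 1 = 1) : multCorrection x y s 1 = 0 := by
  simp [multCorrection_apply, hs]

theorem multCorrection_mem {J : Ideal A} (hs : ∀ a b, multDefect s a b ∈ J) (a : D) :
    multCorrection x y s a ∈ J := by
  rw [multCorrection_apply]
  exact sum_mem fun i _ => J.mul_mem_left _ (hs _ a)

theorem IsSeparabilitySystem.multCorrection_mul (hxy : IsSeparabilitySystem k x y) (hs : s 1 = 1)
    (a b : D) : multCorrection x y s (a * b) =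
      multCorrection x y s a * s b + s a * multCorrection x y s b - multDefect s a b -
        ∑ i, multDefect s a (x i) * multDefect s (y i) b -
        (∑ i, multDefect s (x i) (y i)) * multDefect s a b := by
  have hcomm : ∑ i, s (x i) * multDefect s (y i * a) b =
      ∑ i, s (a * x i) * multDefect s (y i) b :=
    (hxy.sum_apply_comm ((LinearMap.mul k A).compl₁₂ s ((multDefect s).flip b)) a).symm
  have hcocycle : multCorrection x y s (a * b) = multCorrection x y s a * s b +
      ∑ i, s (x i) * multDefect s (y i * a) b -
      (∑ i, s (x i) * s (y i)) * multDefect s a b := by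
    simp only [multCorrection_apply, Finset.sum_mul, ← Finset.sum_add_distrib,
      ← Finset.sum_sub_distrib]
    refine Finset.sum_congr rfl fun i _ => ?_
    simp only [multDefect_apply, ← mul_assoc]
    noncomm_ring
  have hleft : ∑ i, s (a * x i) * multDefect s (y i) b = s a * multCorrection x y s b -
      ∑ i, multDefect s a (x i) * multDefect s (y i) b := by
    simp only [multCorrection_apply, Finset.mul_sum, ← Finset.sum_sub_distrib]
    refine Finset.sum_congr rfl fun i _ => ?_
    simp only [multDefect_apply]
    noncomm_ring
  have hone : ∑ i, s (x i) * s (y i) = ∑ i, multDefect s (x i) (y i) + 1 := by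
    rw [← hs, ← hxy.sum_mul_eq_one, map_sum, ← Finset.sum_add_distrib]
    simp
  rw [hcocycle, hcomm, hleft, hone]
  noncomm_ring

theorem IsSeparabilitySystem.multDefect_sub_multCorrection (hxy : IsSeparabilitySystem k x y)
    (hs : s 1 = 1) (a b : D) : multDefect (s - multCorrection x y s) a b =
      multCorrection x y s a * multCorrection x y s b -
        ∑ i, multDefect s a (x i) * multDefect s (y i) b -
        (∑ i, multDefect s (x i) (y i)) * multDefect s a b := by
  have h := hxy.multCorrection_mul hs a b
  simp only [multDefect_apply, LinearMap.sub_apply] at h ⊢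
  rw [h]
  noncomm_ring

/-- A multiplicative filtration of a ring for which every Cauchy sequence has a unique limit. -/
structure IsCompleteFiltration (I : ℕ → Ideal A) : Prop where
  zero : I 0 = ⊤
  antitone : Antitone I
  mul_mem : ∀ {m n : ℕ} {a b : A}, a ∈ I m → b ∈ I n → a * b ∈ I (m + n)
  eq_zero : ∀ {a : A}, (∀ n, a ∈ I n) → a = 0
  exists_limit : ∀ {u : ℕ → A}, (∀ n, u (n + 1) - u n ∈ I n) → ∃ a, ∀ n, a - u n ∈ I n

namespace IsCompleteFiltration

variable (hI : IsCompleteFiltration I)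
include hI

theorem isTwoSided (n : ℕ) : (I n).IsTwoSided where
  mul_mem_of_left b ha := by simpa using hI.mul_mem ha (b := b) (n := 0) (by simp [hI.zero])

theorem eq_of_forall_sub_mem {a b : A} (h : ∀ n, a - b ∈ I n) : a = b :=
  sub_eq_zero.1 (hI.eq_zero h)

theorem multDefect_sub_multCorrection_mem (hxy : IsSeparabilitySystem k x y) (hs : s 1 = 1)
    {n : ℕ} (hn : ∀ a b, multDefect s a b ∈ I (n + 1)) (a b : D) :
    multDefect (s - multCorrection x y s) a b ∈ I (n + 2) := by
  have hmul : ∀ {c d : A}, c ∈ I (n + 1) → d ∈ I (n + 1) → c * d ∈ I (n + 2) := fun hc hd =>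
    hI.antitone (by omega) (hI.mul_mem hc hd)
  rw [hxy.multDefect_sub_multCorrection hs]
  refine sub_mem (sub_mem (hmul (multCorrection_mem hn a) (multCorrection_mem hn b)) ?_) ?_
  · exact sum_mem fun i _ => hmul (hn _ _) (hn _ _)
  · exact hmul (sum_mem fun i _ => hn _ _) (hn a b)

theorem exists_linearMap_limit {V : Type*} [AddCommGroup V] [Module k V] {S : ℕ → V →ₗ[k] A}
    (hS : ∀ n v, S (n + 1) v - S n v ∈ I n) : ∃ σ : V →ₗ[k] A, ∀ n v, σ v - S n v ∈ I n := by
  choose σ hσ using fun v => hI.exists_limit (u := fun n => S n v) fun n => hS n v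
  refine ⟨{ toFun := σ, map_add' := fun v w => ?_, map_smul' := fun r v => ?_ }, fun n v => hσ v n⟩
  · refine hI.eq_of_forall_sub_mem fun n => ?_
    convert sub_mem (sub_mem (hσ (v + w) n) (hσ v n)) (hσ w n) using 1
    rw [map_add]
    abel
  · refine hI.eq_of_forall_sub_mem fun n => ?_
    convert sub_mem (hσ (r • v) n) (Submodule.smul_of_tower_mem (I n) r (hσ v n)) using 1
    rw [map_smul, smul_sub, RingHom.id_apply]
    abel

theorem map_mul_of_limit {S : ℕ → D →ₗ[k] A} {σ : D →ₗ[k] A} (hσ : ∀ n d, σ d - S n d ∈ I n)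
    (hS : ∀ n a b, multDefect (S n) a b ∈ I n) (a b : D) : σ (a * b) = σ a * σ b := by
  refine hI.eq_of_forall_sub_mem fun n => ?_
  have := hI.isTwoSided n
  have hdefect := hS n a b
  rw [multDefect_apply] at hdefect
  convert sub_mem (sub_mem (sub_mem (hσ n (a * b)) hdefect)
    ((I n).mul_mem_right (σ b) (hσ n a))) ((I n).mul_mem_left (S n a) (hσ n b)) using 1
  noncomm_ring

/-- Newton iteration of `s ↦ s - multCorrection x y s`. -/
theorem exists_algHom_lift (hxy : IsSeparabilitySystem k x y) (hs : s 1 = 1)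
    (hdefect : ∀ a b, multDefect s a b ∈ I 1) : ∃ σ : D →ₐ[k] A, ∀ d, σ d - s d ∈ I 1 := by
  let S : ℕ → D →ₗ[k] A := fun n => (fun t => t - multCorrection x y t)^[n] s
  have hS : ∀ n, S (n + 1) = S n - multCorrection x y (S n) := fun n =>
    Function.iterate_succ_apply' (fun t => t - multCorrection x y t) n s
  have key : ∀ n, S n 1 = 1 ∧ ∀ a b, multDefect (S n) a b ∈ I (n + 1) := by
    intro n
    induction n with
    | zero => exact ⟨hs, hdefect⟩
    | succ n ih =>
      rw [hS]
      refine ⟨?_, hI.multDefect_sub_multCorrection_mem hxy ih.1 ih.2⟩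
      rw [LinearMap.sub_apply, multCorrection_one ih.1, ih.1, sub_zero]
  have hstep : ∀ n d, S (n + 1) d - S n d ∈ I (n + 1) := fun n d => by
    rw [hS, LinearMap.sub_apply, sub_sub_cancel_left]
    exact neg_mem (multCorrection_mem (key n).2 d)
  have hle : ∀ n, I (n + 1) ≤ I n := fun n => hI.antitone n.le_succ
  obtain ⟨σ, hσ⟩ := hI.exists_linearMap_limit fun n d => hle n (hstep n d)
  have hone : σ 1 = 1 := hI.eq_of_forall_sub_mem fun n => by simpa only [(key n).1] using hσ n 1
  refine ⟨AlgHom.ofLinearMap σ hone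
    (hI.map_mul_of_limit hσ fun n a b => hle n ((key n).2 a b)), fun d => ?_⟩
  rw [AlgHom.ofLinearMap_apply, ← sub_add_sub_cancel _ (S 1 d)]
  exact add_mem (hσ 1 d) (hstep 0 d)

end IsCompleteFiltration

theorem exists_linear_section_map_one [Nontrivial D] {r : A →ₐ[k] D}
    (hr : Function.Surjective r) : ∃ s : D →ₗ[k] A, (∀ d, r (s d) = d) ∧ s 1 = 1 := by
  obtain ⟨s, hs⟩ := r.toLinearMap.exists_rightInverse_of_surjective (range_eq_top.2 hr)
  obtain ⟨f, hf⟩ := (Algebra.linearMap k D).exists_leftInverse_of_injective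
    (ker_eq_bot.2 (algebraMap k D).injective)
  have hrs : ∀ d, r (s d) = d := LinearMap.congr_fun hs
  have hf1 : f 1 = 1 := by simpa using LinearMap.congr_fun hf 1
  refine ⟨s + f.smulRight (1 - s 1), fun d => ?_, ?_⟩
  · simp [hrs]
  · simp [hf1]

theorem IsSeparableAlgebra.exists_section [Nontrivial D] (hD : IsSeparableAlgebra k D)
    (hI : IsCompleteFiltration I) {r : A →ₐ[k] D} (hr : Function.Surjective r)
    (hker : ∀ a, r a = 0 ↔ a ∈ I 1) : ∃ s : D →ₐ[k] A, ∀ d, r (s d) = d := by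
  obtain ⟨n, x, y, hxy⟩ := hD.exists_isSeparabilitySystem
  obtain ⟨s, hrs, hs1⟩ := exists_linear_section_map_one hr
  obtain ⟨σ, hσ⟩ := hI.exists_algHom_lift hxy hs1 fun a b => by
    rw [← hker, multDefect_apply, map_sub, map_mul, hrs, hrs, hrs, sub_self]
  refine ⟨σ, fun d => ?_⟩
  have h := (hker _).2 (hσ d)
  rwa [map_sub, hrs, sub_eq_zero] at h

end Lifting

section LocallyFiniteSum

variable {k V W : Type*} [Field k] [AddCommGroup V] [Module k V] [AddCommGroup W] [Module k W]

/-- A sequence of linear maps is locally finite if almost all of its terms vanish on any given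
vector. -/
def IsLocallyFinite (g : ℕ → V →ₗ[k] W) : Prop := ∀ v, ∃ N, ∀ n ≥ N, g n v = 0

theorem finsum_apply_eq_sum_range {g : ℕ → V →ₗ[k] W} {v : V} {N : ℕ}
    (h : ∀ n ≥ N, g n v = 0) : ∑ᶠ n, g n v = ∑ n ∈ Finset.range N, g n v := by
  refine finsum_eq_sum_of_support_subset _ fun n hn => ?_
  rw [Finset.coe_range, Set.mem_Iio]
  exact not_le.1 fun hNn => hn (h n hNn)

theorem IsLocallyFinite.hasFiniteSupport {g : ℕ → V →ₗ[k] W} (hg : IsLocallyFinite g) (v : V) :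
    (Function.support fun n => g n v).Finite := by
  obtain ⟨N, hN⟩ := hg v
  exact (Set.finite_Iio N).subset fun n hn => not_le.1 fun hNn => hn (hN n hNn)

/-- The sum of a locally finite sequence of linear maps. -/
def locallyFiniteSum (g : ℕ → V →ₗ[k] W) (hg : IsLocallyFinite g) : V →ₗ[k] W where
  toFun v := ∑ᶠ n, g n v
  map_add' v w := by
    simp only [map_add]
    exact finsum_add_distrib (hg.hasFiniteSupport v) (hg.hasFiniteSupport w)
  map_smul' r v := by
    simp only [map_smul, RingHom.id_apply]
    exact (smul_finsum' r (hg.hasFiniteSupport v)).symm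

theorem locallyFiniteSum_apply {g : ℕ → V →ₗ[k] W} (hg : IsLocallyFinite g) {v : V} {N : ℕ}
    (h : ∀ n ≥ N, g n v = 0) : locallyFiniteSum g hg v = ∑ n ∈ Finset.range N, g n v :=
  finsum_apply_eq_sum_range h

end LocallyFiniteSum

section DualFiltration

variable {k C : Type*} [Field k] [AddCommGroup C] [Module k C] [Coalgebra k C]
  (hexh : ∀ c : C, ∃ n, c ∈ coradicalFiltration k C n)
include hexh

theorem exists_limit_dualFiltration {u : ℕ → DualAlgebra k C}
    (hu : ∀ n, u (n + 1) - u n ∈ dualFiltration k C n) :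
    ∃ a, ∀ n, a - u n ∈ dualFiltration k C n := by
  let g : ℕ → C →ₗ[k] k := fun n => (u (n + 1) - u n).ofConv
  have hgn : ∀ {n c}, c ∈ coradicalFiltration k C n → ∀ m ≥ n, g m c = 0 := fun hc m hm =>
    hu m _ (coradicalFiltration_mono hm hc)
  have hg : IsLocallyFinite g := fun c => (hexh c).imp fun n hn => hgn hn
  refine ⟨u 0 + toConv (locallyFiniteSum g hg), fun n c hc => ?_⟩
  have hsum : locallyFiniteSum g hg c = u n c - u 0 c :=
    (locallyFiniteSum_apply hg (hgn hc)).trans (Finset.sum_range_sub (fun m => u m c) n)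
  change u 0 c + locallyFiniteSum g hg c - u n c = 0
  rw [hsum]
  ring

theorem isCompleteFiltration_dualFiltration : IsCompleteFiltration (dualFiltration k C) where
  zero := dualFiltration_zero
  antitone := dualFiltration_antitone
  mul_mem := mul_mem_dualFiltration
  eq_zero ha := WithConv.ext <| LinearMap.ext fun c =>
    let ⟨n, hn⟩ := hexh c
    ha n c hn
  exists_limit := exists_limit_dualFiltration hexh

end DualFiltration

/-! ### The first layer of the dual algebra -/

section Generator

theorem exists_twist {k D A : Type*} [Field k] [DivisionRing D] [Algebra k D] [Ring A]
    [Algebra k A] (s : D →ₐ[k] A) {I : Ideal A} [I.IsTwoSided] {j : A} (hj : j ∉ I)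
    (hcomm : ∀ d, ∃ d', s d * j - j * s d' ∈ I) :
    ∃ τ : D →ₐ[k] D, ∀ d, s d * j - j * s (τ d) ∈ I := by
  let R : D →ₗ[k] A ⧸ I := (I.mkQ.restrictScalars k) ∘ₗ mulLeft k j ∘ₗ s.toLinearMap
  let L : D →ₗ[k] A ⧸ I := (I.mkQ.restrictScalars k) ∘ₗ mulRight k j ∘ₗ s.toLinearMap
  have hLR : ∀ {d d'}, L d = R d' ↔ s d * j - j * s d' ∈ I := Submodule.Quotient.eq I
  have hR : Function.Injective R := by
    refine (injective_iff_map_eq_zero R).2 fun d hd => by_contra fun hd0 => hj ?_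
    have hjd : j * s d * s d⁻¹ ∈ I := I.mul_mem_right _ ((Submodule.Quotient.mk_eq_zero I).1 hd)
    rwa [mul_assoc, ← map_mul, mul_inv_cancel₀ hd0, map_one, mul_one] at hjd
  obtain ⟨g, hg⟩ := R.exists_leftInverse_of_injective (ker_eq_bot.2 hR)
  have hτ : ∀ d, L d = R (g (L d)) := fun d => by
    obtain ⟨d', hd'⟩ := hcomm d
    rw [hLR.2 hd', show g (R d') = d' from LinearMap.congr_fun hg d']
  refine ⟨AlgHom.ofLinearMap (g ∘ₗ L) (hR ?_) fun a b => hR ?_, fun d => hLR.1 (hτ d)⟩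
  · refine (hτ 1).symm.trans (hLR.2 ?_)
    rw [map_one, one_mul, mul_one, sub_self]
    exact zero_mem I
  · refine (hτ (a * b)).symm.trans (hLR.2 ?_)
    convert add_mem (I.mul_mem_left (s a) (hLR.1 (hτ b)))
      (I.mul_mem_right (s (g (L b))) (hLR.1 (hτ a))) using 1
    simp only [map_mul, comp_apply]
    noncomm_ring

variable {k C : Type*} [Field k] [AddCommGroup C] [Module k C] [Coalgebra k C]

theorem IsChainCoalgebra.mem_coradical_of_rightHit_eq_zero (hC : IsChainCoalgebra k C)
    (h0 : coradical k C ≠ ⊥) {j : DualAlgebra k C} (hj : j ∉ dualFiltration k C 2) {c : C}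
    (hc : c ∈ coradicalFiltration k C 2) (hjc : rightHit j.ofConv c = 0) : c ∈ coradical k C := by
  have hN : IsRightCoideal
      (coradicalFiltration k C 2 ⊓ (coradicalFiltration k C 0).comap (rightHit j.ofConv)) :=
    isRightCoideal_comap _ (isRightCoideal_coradicalFiltration 2)
      (isRightCoideal_coradicalFiltration 0)
  refine hC.le_coradical_of_lt h0 hN (inf_le_left.lt_of_ne fun heq => hj fun x hx => ?_)
    ⟨hc, by simp [hjc]⟩
  have hjx : rightHit j.ofConv x = 0 := by simpa using (heq.ge hx).2
  have h := mul_apply_rightHit j 1 x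
  rw [mul_one, hjx] at h
  exact h.trans (map_zero _)

variable {D : Type*} [DivisionRing D] [Algebra k D] [FiniteDimensional k D]
  {s : D →ₐ[k] DualAlgebra k C}

/-- The functionals `j * s d` on `C₁` span a finite dimensional space, whose common kernel is
`C₀`. -/
theorem IsChainCoalgebra.exists_sub_mul_mem (hC : IsChainCoalgebra k C) (h0 : coradical k C ≠ ⊥)
    (hs : ∀ a, ∃ d, a - s d ∈ coradicalIdeal k C) {j : DualAlgebra k C}
    (hjI : j ∈ coradicalIdeal k C) (hj : j ∉ dualFiltration k C 2) {b : DualAlgebra k C}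
    (hb : b ∈ coradicalIdeal k C) : ∃ d, b - j * s d ∈ dualFiltration k C 2 := by
  let restrict : DualAlgebra k C →ₗ[k] Dual k (coradicalFiltration k C 2) :=
    (coradicalFiltration k C 2).subtype.dualMap ∘ₗ
      (WithConv.linearEquiv k (C →ₗ[k] k)).toLinearMap
  let Λ : D →ₗ[k] Dual k (coradicalFiltration k C 2) :=
    restrict ∘ₗ mulLeft k j ∘ₗ s.toLinearMap
  have hmem : restrict b ∈ range Λ := by
    rw [← Subspace.dualCoannihilator_dualAnnihilator_eq (W := range Λ),
      Submodule.mem_dualAnnihilator]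
    intro c hc
    have hjs : ∀ d, (j * s d) c.1 = 0 := fun d =>
      (Submodule.mem_dualCoannihilator c).1 hc (Λ d) ⟨d, rfl⟩
    refine mem_coradicalIdeal.1 hb c ?_
    refine hC.mem_coradical_of_rightHit_eq_zero h0 hj c.2
      (eq_of_forall_functional (k := k) fun a => ?_)
    obtain ⟨d, hd⟩ := hs (toConv a)
    rw [← dualFiltration_one] at hjI hd
    have hja : (j * (toConv a - s d)) c.1 = 0 := mul_mem_dualFiltration hjI hd c c.2
    have hsub : (j * toConv a) c.1 - (j * s d) c.1 = 0 := by
      rw [mul_sub] at hja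
      exact hja
    rw [hjs, sub_zero, mul_apply_rightHit] at hsub
    exact hsub.trans (map_zero a).symm
  obtain ⟨d, hd⟩ := hmem
  exact ⟨d, fun c hc => sub_eq_zero.2 (LinearMap.congr_fun hd ⟨c, hc⟩).symm⟩

theorem IsChainCoalgebra.exists_generator (hC : IsChainCoalgebra k C) (h0 : coradical k C ≠ ⊥)
    (hD : IsSeparableAlgebra k D) (hs : ∀ a, ∃ d, a - s d ∈ coradicalIdeal k C) :
    ∃ (τ : D →ₐ[k] D) (m : DualAlgebra k C), m ∈ coradicalIdeal k C ∧
      (∀ d, s d * m = m * s (τ d)) ∧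
      ∀ b ∈ coradicalIdeal k C, ∃ d, b - m * s d ∈ dualFiltration k C 2 := by
  by_cases hle : coradicalIdeal k C ≤ dualFiltration k C 2
  · exact ⟨AlgHom.id k D, 0, zero_mem _, by simp, fun b hb => ⟨0, by simpa using hle hb⟩⟩
  obtain ⟨j, hjI, hj⟩ := SetLike.not_le_iff_exists.1 hle
  obtain ⟨τ, hτ⟩ := exists_twist s hj fun d =>
    hC.exists_sub_mul_mem h0 hs hjI hj (Ideal.mul_mem_left _ (s d) hjI)
  obtain ⟨n, x, y, hxy⟩ := hD.exists_isSeparabilitySystem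
  have hm := hxy.average_sub_mem s (s.comp τ) j hτ
  have hI : dualFiltration k C 2 ≤ coradicalIdeal k C := by
    rw [← dualFiltration_one]
    exact dualFiltration_antitone one_le_two
  refine ⟨τ, _, (Submodule.sub_mem_iff_left _ hjI).1 (hI hm), hxy.average_comm s (s.comp τ) j,
    fun b hb => ?_⟩
  obtain ⟨d, hd⟩ := hC.exists_sub_mul_mem h0 hs hjI hj hb
  refine ⟨d, ?_⟩
  convert sub_mem hd (Ideal.mul_mem_right (s d) _ hm) using 1
  rw [sub_mul, sub_sub_sub_cancel_right]

end Generator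

section Density

variable {k C T : Type*} [Field k] [AddCommGroup C] [Module k C] [Coalgebra k C]
  [AddCommGroup T] [Module k T] [Coalgebra k T]

theorem eq_zero_of_forall_dualMap {φ : C →ₗc[k] T}
    (hdense : ∀ a, ∃ b, a - dualMap φ b ∈ dualFiltration k C 2) {n : ℕ} {c : C}
    (hc : c ∈ coradicalFiltration k C n) (hφ : ∀ b, dualMap φ b c = 0) : c = 0 := by
  induction n generalizing c with
  | zero => simpa using hc
  | succ n ih =>
    rcases n with _ | n
    · refine eq_of_forall_functional (k := k) fun f => ?_
      obtain ⟨b, hb⟩ := hdense (toConv f)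
      have h : f c - dualMap φ b c = 0 := hb c (coradicalFiltration_mono one_le_two hc)
      rwa [hφ, sub_zero, ← map_zero f] at h
    · refine ih (mem_coradicalFiltration_succ.2 fun a ha => ?_) hφ
      obtain ⟨b, hb⟩ := hdense a
      have hbI : dualMap φ b ∈ dualFiltration k C 1 := by
        rw [← dualFiltration_one] at ha
        exact (Submodule.sub_mem_iff_right _ ha).1 (dualFiltration_antitone one_le_two hb)
      have hbc : rightHit (dualMap φ b).ofConv c = 0 := by
        refine ih (rightHit_mem_coradicalFiltration hbI (by rwa [add_comm 1])) fun b' => ?_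
        rw [← mul_apply_rightHit, ← map_mul]
        exact hφ _
      have hsub : rightHit (a - dualMap φ b).ofConv c = rightHit a.ofConv c := by
        simp [rightHit, rTensor_sub, ← hbc]
      rw [← hsub]
      exact rightHit_mem_coradicalFiltration hb (by rwa [add_comm 2])

theorem coalgHom_injective_of_dense {φ : C →ₗc[k] T}
    (hexh : ∀ c : C, ∃ n, c ∈ coradicalFiltration k C n)
    (hdense : ∀ a, ∃ b, a - dualMap φ b ∈ dualFiltration k C 2) : Function.Injective φ := by
  refine (injective_iff_map_eq_zero φ).2 fun c hc => ?_
  obtain ⟨n, hn⟩ := hexh c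
  exact eq_zero_of_forall_dualMap hdense hn fun b => by rw [dualMap_apply, hc, map_zero]

end Density

/-! ### Maps into the cotensor coalgebra -/

section SliceDetection

variable {k V W : Type*} [Field k] [AddCommGroup V] [Module k V] [AddCommGroup W] [Module k W]
  {z : V ⊗[k] W}

theorem eq_zero_of_forall_leftSlice (h : ∀ g, leftSlice W g z = 0) : z = 0 := by
  obtain ⟨y, rfl⟩ :=
    mem_range_lTensor_of (⊥ : Submodule k W) z fun g => (Submodule.mem_bot k).2 (h g)
  rw [Subsingleton.elim y 0, map_zero]

theorem eq_zero_of_forall_rightSlice (h : ∀ g, rightSlice V g z = 0) : z = 0 := by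
  obtain ⟨y, rfl⟩ :=
    (mem_range_rTensor_iff (⊥ : Submodule k V) z).2 fun g => (Submodule.mem_bot k).2 (h g)
  rw [Subsingleton.elim y 0, map_zero]

end SliceDetection

section LocallyFiniteSum

variable {k V W V' W' : Type*} [Field k] [AddCommGroup V] [Module k V] [AddCommGroup W]
  [Module k W] [AddCommGroup V'] [Module k V'] [AddCommGroup W'] [Module k W']
  {g : ℕ → V →ₗ[k] W} {g' : ℕ → V' →ₗ[k] W'}

theorem apply_locallyFiniteSum_eq_single (hg : IsLocallyFinite g) (p : W →ₗ[k] W') {m : ℕ}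
    (h : ∀ n ≠ m, p ∘ₗ g n = 0) (v : V) : p (locallyFiniteSum g hg v) = p (g m v) :=
  (p.toAddMonoidHom.map_finsum (hg.hasFiniteSupport v)).trans <|
    finsum_eq_single _ m fun n hn => LinearMap.congr_fun (h n hn) v

theorem map_locallyFiniteSum (hg : IsLocallyFinite g) (hg' : IsLocallyFinite g') (z : V ⊗[k] V') :
    ∃ N₀, ∀ N ≥ N₀, TensorProduct.map (locallyFiniteSum g hg) (locallyFiniteSum g' hg') z =
      ∑ a ∈ Finset.range N, ∑ b ∈ Finset.range N, TensorProduct.map (g a) (g' b) z := by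
  induction z with
  | zero => exact ⟨0, fun N _ => by simp⟩
  | add x y hx hy =>
    obtain ⟨m, hm⟩ := hx
    obtain ⟨n, hn⟩ := hy
    refine ⟨max m n, fun N hN => ?_⟩
    simp only [map_add, Finset.sum_add_distrib]
    rw [hm N (le_of_max_le_left hN), hn N (le_of_max_le_right hN)]
  | tmul x y =>
    obtain ⟨m, hm⟩ := hg x
    obtain ⟨n, hn⟩ := hg' y
    refine ⟨max m n, fun N hN => ?_⟩
    rw [map_tmul, locallyFiniteSum_apply hg fun i hi => hm i ((le_of_max_le_left hN).trans hi),
      locallyFiniteSum_apply hg' fun i hi => hn i ((le_of_max_le_right hN).trans hi),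
      TensorProduct.sum_tmul]
    simp only [TensorProduct.tmul_sum, map_tmul]

end LocallyFiniteSum

namespace CotensorCoalgebra

variable {k C M : Type*} [Field k] [AddCommGroup C] [Module k C] [Coalgebra k C]
  [AddCommGroup M] [Module k M] [Bicomodule k C M]

variable (k C M) in
/-- The projection of the cotensor coalgebra onto `C`. -/
def projC : CotensorCoalgebra k C M →ₗc[k] C where
  __ := desc k C M LinearMap.id fun _ => 0
  counit_comp := hom_ext (fun c => by simp [desc_ofC, counit_ofC])
    fun n x => by simp [desc_ofPow, counit_ofPow]
  map_comp_comul := by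
    have hP : ∀ n, desc k C M LinearMap.id (fun _ => 0) ∘ₗ ofPow k C M n = 0 := fun n =>
      LinearMap.ext fun x => desc_ofPow _ _ n x
    have hC : desc k C M LinearMap.id (fun _ => 0) ∘ₗ ofC k C M = LinearMap.id :=
      LinearMap.ext fun c => desc_ofC _ _ c
    refine hom_ext (fun c => ?_) fun n x => ?_
    · rw [comp_apply, comp_apply, comul_ofC, ← comp_apply, ← TensorProduct.map_comp, hC,
        TensorProduct.map_id, desc_ofC]
      rfl
    · rw [comp_apply, comp_apply, comul_ofPow, desc_ofPow, map_add, map_sum,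
        Finset.sum_eq_zero fun i _ => ?_, ← comp_apply, ← TensorProduct.map_comp, hP]
      · simp
      · rw [← map_comp_left, hP, map_zero_left, LinearMap.zero_apply]

variable (k C M) in
/-- The projection of the cotensor coalgebra onto the cotensor power with `n + 1` factors. -/
def projPow (n : ℕ) : CotensorCoalgebra k C M →ₗ[k] (cotensorPow k C M n).carrier :=
  DirectSum.component k ℕ (fun n => (cotensorPow k C M n).carrier) n ∘ₗ LinearMap.snd k C _

@[simp] theorem projC_ofC (c : C) : projC k C M (ofC k C M c) = c := desc_ofC _ _ c

@[simp] theorem projC_ofPow (n : ℕ) (x : (cotensorPow k C M n).carrier) :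
    projC k C M (ofPow k C M n x) = 0 := desc_ofPow _ _ n x

@[simp] theorem projPow_ofC (n : ℕ) (c : C) : projPow k C M n (ofC k C M c) = 0 := rfl

@[simp] theorem projPow_ofPow_self (n : ℕ) (x : (cotensorPow k C M n).carrier) :
    projPow k C M n (ofPow k C M n x) = x :=
  DirectSum.component.lof_self (M := fun n => (cotensorPow k C M n).carrier) k n x

theorem projPow_ofPow_of_ne {m n : ℕ} (h : m ≠ n) (x : (cotensorPow k C M m).carrier) :
    projPow k C M n (ofPow k C M m x) = 0 :=
  (DirectSum.component.of (M := fun n => (cotensorPow k C M n).carrier) k n m x).trans (dif_neg h)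

theorem ofC_injective : Function.Injective (ofC k C M) :=
  Function.LeftInverse.injective (projC_ofC (k := k) (M := M))

theorem ofPow_injective (n : ℕ) : Function.Injective (ofPow k C M n) :=
  Function.LeftInverse.injective (projPow_ofPow_self n)

end CotensorCoalgebra

section Lift

open CotensorCoalgebra

variable {k : Type u} {E : Type v} {P : Type w} {C : Type*} [Field k] [AddCommGroup E]
  [Module k E] [Coalgebra k E] [AddCommGroup P] [Module k P] [Bicomodule k E P]
  [AddCommGroup C] [Module k C] [Coalgebra k C] {f₀ : C →ₗc[k] E} {f₁ : C →ₗ[k] P}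

/-- Left colinearity of a map from `C` to an `E`-comodule, when `C` is made an `E`-comodule through
a coalgebra map `f₀ : C → E`. -/
def IsColinearAlong (f₀ : C →ₗc[k] E) (X : LeftComod.{u, v, w} k E) (f : C →ₗ[k] X.carrier) :
    Prop :=
  X.coact ∘ₗ f = TensorProduct.map f₀.toLinearMap f ∘ₗ Coalgebra.comul

/-- Colinearity on both sides of a map from `C` to an `E`-bicomodule, when `C` is made an
`E`-bicomodule through a coalgebra map `f₀ : C → E`. -/
structure IsBicolinearAlong (f₀ : C →ₗc[k] E) (f₁ : C →ₗ[k] P) : Prop where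
  coactL_comp : (coactL : P →ₗ[k] E ⊗[k] P) ∘ₗ f₁ =
    TensorProduct.map f₀.toLinearMap f₁ ∘ₗ Coalgebra.comul
  coactR_comp : (coactR : P →ₗ[k] P ⊗[k] E) ∘ₗ f₁ =
    TensorProduct.map f₁ f₀.toLinearMap ∘ₗ Coalgebra.comul

theorem map_map_comul {U V W : Type*} [AddCommGroup U] [Module k U] [AddCommGroup V] [Module k V]
    [AddCommGroup W] [Module k W] (f : C →ₗ[k] U) (g : C →ₗ[k] V) (h : C →ₗ[k] W) (c : C) :
    TensorProduct.assoc k U V W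
      (TensorProduct.map (TensorProduct.map f g ∘ₗ Coalgebra.comul) h
        (Coalgebra.comul (R := k) c)) =
    TensorProduct.map f (TensorProduct.map g h ∘ₗ Coalgebra.comul)
      (Coalgebra.comul (R := k) c) := by
  rw [map_comp_left, map_map_assoc, Coalgebra.coassoc_apply, map_comp_right]

namespace IsBicolinearAlong

variable (h : IsBicolinearAlong f₀ f₁)

section CotensorLift

variable {X : LeftComod.{u, v, w} k E} {f : C →ₗ[k] X.carrier} (hf : IsColinearAlong f₀ X f)

include h hf in
theorem map_comul_mem_cotensor (c : C) :
    TensorProduct.map f₁ f (Coalgebra.comul (R := k) c) ∈ cotensor P X := by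
  change X.coact.lTensor P _ = TensorProduct.assoc k P E X.carrier
    ((coactR : P →ₗ[k] P ⊗[k] E).rTensor X.carrier _)
  rw [lTensor_map, rTensor_map, hf, h.coactR_comp, map_map_comul]

/-- The map `c ↦ ∑ f₁(c₁) □ f(c₂)`. -/
def cotensorLift : C →ₗ[k] cotensor P X :=
  (TensorProduct.map f₁ f ∘ₗ Coalgebra.comul).codRestrict (cotensor P X)
    (h.map_comul_mem_cotensor hf)

theorem subtype_comp_cotensorLift : (cotensor P X).subtype ∘ₗ h.cotensorLift hf =
    TensorProduct.map f₁ f ∘ₗ Coalgebra.comul := rfl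

theorem isColinearAlong_cotensorLift :
    IsColinearAlong f₀ (cotensorComod P X) (h.cotensorLift hf) := by
  refine LinearMap.ext fun c => lTensor_subtype_injective E (cotensor P X) ?_
  refine (cotensorCoact_apply P X _).trans ?_
  rw [comp_apply, lTensor_map, subtype_comp_cotensorLift]
  change TensorProduct.assoc k E P X.carrier ((coactL : P →ₗ[k] E ⊗[k] P).rTensor X.carrier
    (TensorProduct.map f₁ f (Coalgebra.comul (R := k) c))) = _
  rw [rTensor_map, h.coactL_comp, map_map_comul]

end CotensorLift

/-- The colinear maps `c ↦ ∑ f₁(c₁) □ ⋯ □ f₁(cₙ₊₁)`. -/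
def colinearPowLift : (n : ℕ) →
    {f : C →ₗ[k] (cotensorPow k E P n).carrier // IsColinearAlong f₀ (cotensorPow k E P n) f}
  | 0 => ⟨f₁, h.coactL_comp⟩
  | n + 1 => ⟨h.cotensorLift (colinearPowLift n).2, h.isColinearAlong_cotensorLift _⟩

/-- The map `c ↦ ∑ f₁(c₁) □ ⋯ □ f₁(cₙ₊₁)`. -/
def powLift (n : ℕ) : C →ₗ[k] (cotensorPow k E P n).carrier := (h.colinearPowLift n).1

theorem isColinearAlong_powLift (n : ℕ) :
    IsColinearAlong f₀ (cotensorPow k E P n) (h.powLift n) := (h.colinearPowLift n).2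

theorem subtype_powLift_succ (n : ℕ) (c : C) :
    (cotensor P (cotensorPow k E P n)).subtype (h.powLift (n + 1) c) =
      TensorProduct.map f₁ (h.powLift n) (Coalgebra.comul (R := k) c) := rfl

/-- The components of the map from `C` to the cotensor coalgebra which extends `f₀` and `f₁`. -/
def homogeneousLift : ℕ → (C →ₗ[k] CotensorCoalgebra k E P)
  | 0 => ofC k E P ∘ₗ f₀.toLinearMap
  | n + 1 => ofPow k E P n ∘ₗ h.powLift n

theorem split_powLift : ∀ (n i : ℕ) (_ : i ≤ n) (c : C), split k E P n i (h.powLift n c) =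
    TensorProduct.map (h.powLift i) (h.homogeneousLift (n - i)) (Coalgebra.comul (R := k) c)
  | 0, 0, _, c => by
    have hc := congrArg ((ofC k E P).lTensor P) (LinearMap.congr_fun h.coactR_comp c)
    rwa [comp_apply _ Coalgebra.comul, lTensor_map] at hc
  | n + 1, 0, _, c => by
    have hc := congrArg ((ofPow k E P n).lTensor P) (h.subtype_powLift_succ n c)
    rwa [lTensor_map] at hc
  | n + 1, i + 1, hi, c => by
    have hsplit : split k E P n i ∘ₗ h.powLift n =
        TensorProduct.map (h.powLift i) (h.homogeneousLift (n - i)) ∘ₗ Coalgebra.comul :=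
      LinearMap.ext (split_powLift n i (Nat.le_of_succ_le_succ hi))
    rw [Nat.add_sub_add_right]
    apply split_aux_injective (cotensorPow k E P i)
    calc
      _ = (split k E P n i).lTensor P
            (TensorProduct.map f₁ (h.powLift n) (Coalgebra.comul (R := k) c)) :=
        cotensorMap_apply P (split k E P n i) (split_colinear n i) (h.powLift (n + 1) c)
      _ = TensorProduct.assoc k P _ _ (TensorProduct.map
            (TensorProduct.map f₁ (h.powLift i) ∘ₗ Coalgebra.comul)
            (h.homogeneousLift (n - i)) (Coalgebra.comul (R := k) c)) := by
        rw [lTensor_map, hsplit, map_map_comul]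
      _ = _ := congrArg (TensorProduct.assoc k P _ _)
        (rTensor_map (cotensor P (cotensorPow k E P i)).subtype
          (h.cotensorLift (h.isColinearAlong_powLift i)) _ _).symm

theorem map_homogeneousLift_zero_zero (c : C) :
    TensorProduct.map (h.homogeneousLift 0) (h.homogeneousLift 0) (Coalgebra.comul (R := k) c) =
      TensorProduct.map (ofC k E P) (ofC k E P) (Coalgebra.comul (R := k) (f₀ c)) := by
  rw [← CoalgHomClass.map_comp_comul_apply]
  exact LinearMap.congr_fun (TensorProduct.map_comp _ _ _ _) _

theorem map_homogeneousLift_zero_succ (n : ℕ) (c : C) :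
    TensorProduct.map (h.homogeneousLift 0) (h.homogeneousLift (n + 1))
        (Coalgebra.comul (R := k) c) =
      TensorProduct.map (ofC k E P) (ofPow k E P n)
        ((cotensorPow k E P n).coact (h.powLift n c)) := by
  rw [← comp_apply (cotensorPow k E P n).coact, h.isColinearAlong_powLift n]
  exact LinearMap.congr_fun (TensorProduct.map_comp _ _ _ _) _

theorem map_homogeneousLift_succ {n i : ℕ} (hi : i ≤ n) (c : C) :
    TensorProduct.map (h.homogeneousLift (i + 1)) (h.homogeneousLift (n - i))
        (Coalgebra.comul (R := k) c) =
      (ofPow k E P i).rTensor _ (split k E P n i (h.powLift n c)) := by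
  rw [h.split_powLift _ _ hi, rTensor_map]
  rfl

theorem comul_homogeneousLift (n : ℕ) (c : C) :
    Coalgebra.comul (R := k) (h.homogeneousLift n c) =
      ∑ i ∈ Finset.range (n + 1), TensorProduct.map (h.homogeneousLift i)
        (h.homogeneousLift (n - i)) (Coalgebra.comul (R := k) c) := by
  cases n with
  | zero =>
    rw [Finset.sum_range_one, map_homogeneousLift_zero_zero]
    exact comul_ofC (f₀ c)
  | succ n =>
    rw [Finset.sum_range_succ', Nat.sub_zero, map_homogeneousLift_zero_succ]
    refine (comul_ofPow n (h.powLift n c)).trans ((add_comm _ _).trans (congrArg (· + _) ?_))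
    refine Finset.sum_congr rfl fun i hi => ?_
    rw [Nat.add_sub_add_right, h.map_homogeneousLift_succ (Finset.mem_range_succ_iff.1 hi)]

theorem map_homogeneousLift_eq_zero {a b : ℕ} {c : C} (hc : h.homogeneousLift (a + b) c = 0) :
    TensorProduct.map (h.homogeneousLift a) (h.homogeneousLift b) (Coalgebra.comul (R := k) c) =
      0 := by
  rcases a with _ | a
  · rcases b with _ | b
    · have h0 : f₀ c = 0 := (map_eq_zero_iff _ ofC_injective).1 hc
      rw [map_homogeneousLift_zero_zero, h0, map_zero, map_zero]
    · rw [zero_add] at hc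
      have hpow : h.powLift b c = 0 := (map_eq_zero_iff _ (ofPow_injective b)).1 hc
      rw [map_homogeneousLift_zero_succ, hpow, map_zero, map_zero]
  · rw [Nat.add_right_comm] at hc
    have hpow : h.powLift (a + b) c = 0 := (map_eq_zero_iff _ (ofPow_injective _)).1 hc
    have hsplit := h.map_homogeneousLift_succ (Nat.le_add_right a b) c
    rwa [Nat.add_sub_cancel_left, hpow, map_zero, map_zero] at hsplit

variable (hfin : IsLocallyFinite h.homogeneousLift)

theorem comul_locallyFiniteSum (c : C) :
    Coalgebra.comul (R := k) (locallyFiniteSum h.homogeneousLift hfin c) =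
      TensorProduct.map (locallyFiniteSum h.homogeneousLift hfin)
        (locallyFiniteSum h.homogeneousLift hfin) (Coalgebra.comul (R := k) c) := by
  obtain ⟨m, hm⟩ := hfin c
  obtain ⟨n, hn⟩ := map_locallyFiniteSum hfin hfin (Coalgebra.comul (R := k) c)
  rw [hn _ (le_max_right m n),
    locallyFiniteSum_apply hfin fun i hi => hm i ((le_max_left m n).trans hi), map_sum]
  simp only [h.comul_homogeneousLift]
  rw [Finset.sum_range_diag_flip (max m n) fun a b => TensorProduct.map (h.homogeneousLift a)
    (h.homogeneousLift b) (Coalgebra.comul (R := k) c)]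
  refine Finset.sum_congr rfl fun a _ => ?_
  refine Finset.sum_subset (Finset.range_mono (Nat.sub_le _ _)) fun b _ hb => ?_
  refine h.map_homogeneousLift_eq_zero (hm _ ?_)
  rw [Finset.mem_range, not_lt] at hb
  omega

theorem projC_locallyFiniteSum (c : C) :
    projC k E P (locallyFiniteSum h.homogeneousLift hfin c) = f₀ c := by
  refine (apply_locallyFiniteSum_eq_single hfin (projC k E P).toLinearMap (m := 0) ?_ c).trans
    (projC_ofC _)
  rintro (_ | n) hn
  · exact absurd rfl hn
  · exact LinearMap.ext fun x => projC_ofPow n _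

theorem projPow_locallyFiniteSum (n : ℕ) (c : C) :
    projPow k E P n (locallyFiniteSum h.homogeneousLift hfin c) = h.powLift n c := by
  refine (apply_locallyFiniteSum_eq_single hfin (projPow k E P n) (m := n + 1) ?_ c).trans
    (projPow_ofPow_self n _)
  rintro (_ | m) hm
  · exact LinearMap.ext fun x => projPow_ofC n (f₀ x)
  · exact LinearMap.ext fun x => projPow_ofPow_of_ne (by omega) _

/-- The coalgebra map to the cotensor coalgebra which extends `f₀` and `f₁`. -/
def lift : C →ₗc[k] CotensorCoalgebra k E P where
  __ := locallyFiniteSum h.homogeneousLift hfin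
  counit_comp := LinearMap.ext fun c =>
    calc
      _ = Coalgebra.counit (R := k)
            (projC k E P (locallyFiniteSum h.homogeneousLift hfin c)) :=
        (CoalgHomClass.counit_comp_apply (projC k E P) _).symm
      _ = _ := by rw [projC_locallyFiniteSum, CoalgHomClass.counit_comp_apply]
  map_comp_comul := LinearMap.ext fun c => (h.comul_locallyFiniteSum hfin c).symm

@[simp] theorem projC_lift (c : C) : projC k E P (h.lift hfin c) = f₀ c :=
  h.projC_locallyFiniteSum hfin c

@[simp] theorem projPow_lift (n : ℕ) (c : C) :
    projPow k E P n (h.lift hfin c) = h.powLift n c :=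
  h.projPow_locallyFiniteSum hfin n c

end IsBicolinearAlong

end Lift

section Vanishing

variable {k : Type u} {E : Type v} {P : Type w} {C : Type*} [Field k] [AddCommGroup E]
  [Module k E] [Coalgebra k E] [AddCommGroup P] [Module k P] [Bicomodule k E P]
  [AddCommGroup C] [Module k C] [Coalgebra k C] {f₀ : C →ₗc[k] E} {f₁ : C →ₗ[k] P}

theorem map_comul_eq_zero {V W : Type*} [AddCommGroup V] [Module k V] [AddCommGroup W] [Module k W]
    {f : C →ₗ[k] V} {g : C →ₗ[k] W} {m n : ℕ} (hf : ∀ c ∈ coradicalFiltration k C m, f c = 0)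
    (hg : ∀ c ∈ coradicalFiltration k C n, g c = 0) {c : C}
    (hc : c ∈ coradicalFiltration k C (m + n)) :
    TensorProduct.map f g (Coalgebra.comul (R := k) c) = 0 :=
  eq_zero_of_forall_leftSlice fun e => by
    have he : toConv (e ∘ₗ f) ∈ dualFiltration k C m := fun x hx =>
      (congrArg e (hf x hx)).trans (map_zero e)
    rw [leftSlice_map]
    exact hg _ (rightHit_mem_coradicalFiltration he hc)

namespace IsBicolinearAlong

variable (h : IsBicolinearAlong f₀ f₁) (hf₁ : ∀ c ∈ coradicalFiltration k C 1, f₁ c = 0)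
include hf₁

theorem powLift_eq_zero {n : ℕ} {c : C} (hc : c ∈ coradicalFiltration k C (n + 1)) :
    h.powLift n c = 0 := by
  induction n generalizing c with
  | zero => exact hf₁ c hc
  | succ n ih =>
    refine Subtype.ext ((h.subtype_powLift_succ n c).trans ?_)
    exact map_comul_eq_zero hf₁ (fun x hx => ih hx) (by rwa [add_comm 1])

theorem isLocallyFinite_homogeneousLift (hexh : ∀ c : C, ∃ n, c ∈ coradicalFiltration k C n) :
    IsLocallyFinite h.homogeneousLift := fun c => by
  obtain ⟨N, hN⟩ := hexh c
  refine ⟨N + 1, fun n hn => ?_⟩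
  obtain ⟨n, rfl⟩ := Nat.exists_eq_succ_of_ne_zero (by omega : n ≠ 0)
  have hpow := h.powLift_eq_zero hf₁ (coradicalFiltration_mono (by omega : N ≤ n + 1) hN)
  exact (congrArg (CotensorCoalgebra.ofPow k E P n) hpow).trans (map_zero _)

end IsBicolinearAlong

end Vanishing

/-! ### Twisted bimodules and the embedding -/

section Twist

variable {k D : Type*} [Field k] [Ring D] [Algebra k D]

/-- The regular right `D`-module, on which `D` acts from the left through an endomorphism. -/
def TwistedBimodule (_ : D →ₐ[k] D) : Type _ := D

namespace TwistedBimodule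

variable (τ : D →ₐ[k] D)

instance : AddCommGroup (TwistedBimodule τ) := inferInstanceAs (AddCommGroup D)

instance : Module k (TwistedBimodule τ) := inferInstanceAs (Module k D)

instance [FiniteDimensional k D] : FiniteDimensional k (TwistedBimodule τ) :=
  inferInstanceAs (FiniteDimensional k D)

instance : Module D (TwistedBimodule τ) := Module.compHom D τ.toRingHom

instance : Module Dᵐᵒᵖ (TwistedBimodule τ) := inferInstanceAs (Module Dᵐᵒᵖ D)

/-- The identification of the underlying spaces, which turns the left action of `d` into left
multiplication by `τ d`. -/
def equiv : TwistedBimodule τ ≃ₗ[k] D := LinearEquiv.refl k D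

theorem equiv_smul (d : D) (x : TwistedBimodule τ) : equiv τ (d • x) = τ d * equiv τ x := rfl

instance : IsScalarTower k D (TwistedBimodule τ) where
  smul_assoc t d x := (equiv τ).injective (by
    rw [equiv_smul, map_smul, map_smul, equiv_smul, smul_mul_assoc])

instance : IsScalarTower k Dᵐᵒᵖ (TwistedBimodule τ) := inferInstanceAs (IsScalarTower k Dᵐᵒᵖ D)

instance : SMulCommClass D Dᵐᵒᵖ (TwistedBimodule τ) where
  smul_comm a b x := (equiv τ).injective (mul_assoc (τ a) (equiv τ x) b.unop).symm

end TwistedBimodule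

end Twist

section Transpose

variable {k C U V L : Type*} [Field k] [AddCommGroup C] [Module k C] [AddCommGroup U]
  [Module k U] [AddCommGroup V] [Module k V] [AddCommGroup L] [Module k L]

/-- The map `C → V*` transpose to a map from `V` to the dual algebra of `C`. -/
def transpose (F : V →ₗ[k] DualAlgebra k C) : C →ₗ[k] Dual k V :=
  ((WithConv.linearEquiv k (C →ₗ[k] k)).toLinearMap ∘ₗ F).flip

variable [Coalgebra k C]

theorem dualDistrib_map_transpose (F : U →ₗ[k] DualAlgebra k C) (G : V →ₗ[k] DualAlgebra k C)
    (c : C) (x : U) (y : V) :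
    dualDistrib k U V
      (TensorProduct.map (transpose F) (transpose G) (Coalgebra.comul (R := k) c)) (x ⊗ₜ y) =
      (F x * G y) c := by
  rw [convMul_apply]
  generalize Coalgebra.comul (R := k) c = z
  induction z with
  | zero => simp
  | add z z' hz hz' => simp only [map_add, LinearMap.add_apply, hz, hz']
  | tmul c c' => simp [transpose]

theorem codual_transpose [FiniteDimensional k U] [FiniteDimensional k V] {μ : U ⊗[k] V →ₗ[k] L}
    {F : U →ₗ[k] DualAlgebra k C} {G : V →ₗ[k] DualAlgebra k C} {H : L →ₗ[k] DualAlgebra k C}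
    (h : ∀ x y, H (μ (x ⊗ₜ y)) = F x * G y) :
    codual μ ∘ₗ transpose H =
      TensorProduct.map (transpose F) (transpose G) ∘ₗ Coalgebra.comul := by
  refine LinearMap.ext fun c => dualDistrib_injective ?_
  rw [comp_apply, comp_apply, dualDistrib_codual]
  refine TensorProduct.ext' fun x y => ?_
  rw [dualDistrib_map_transpose, ← h]
  rfl

variable {D : Type*} [Ring D] [Algebra k D] [FiniteDimensional k D]

/-- The coalgebra map `C → D*` transpose to an algebra map from `D` to the dual algebra of `C`. -/
def coalgTranspose (s : D →ₐ[k] DualAlgebra k C) : C →ₗc[k] Dual k D where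
  __ := transpose s.toLinearMap
  counit_comp := LinearMap.ext fun c => LinearMap.congr_fun (congrArg ofConv (map_one s)) c
  map_comp_comul := (codual_transpose fun x y => by simp).symm

theorem isBicolinearAlong_transpose_mulLeft {s : D →ₐ[k] DualAlgebra k C} {τ : D →ₐ[k] D}
    {m : DualAlgebra k C} (hm : ∀ d, s d * m = m * s (τ d)) :
    IsBicolinearAlong (coalgTranspose s) (transpose
      (LinearMap.mulLeft k m ∘ₗ s.toLinearMap ∘ₗ (TwistedBimodule.equiv τ).toLinearMap)) where
  coactL_comp := codual_transpose fun d x => by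
    simp [TwistedBimodule.equiv_smul, ← mul_assoc, hm]
  coactR_comp := codual_transpose fun x d =>
    (congrArg (m * ·) (map_mul s (TwistedBimodule.equiv τ x) d)).trans (mul_assoc m _ _).symm

end Transpose

section Embedding

open CotensorCoalgebra

variable {k : Type u} {D : Type v} {C : Type t} [Field k] [AddCommGroup C] [Module k C]
  [Coalgebra k C]

theorem IsSeparableAlgebra.exists_coradical_section [Ring D] [Nontrivial D] [Algebra k D]
    (hD : IsSeparableAlgebra k D) (hexh : ∀ c : C, ∃ n, c ∈ coradicalFiltration k C n)
    (e : DualAlgebra k (coradical k C) ≃ₐ[k] D) :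
    ∃ s : D →ₐ[k] DualAlgebra k C, ∀ a, ∃ d, a - s d ∈ coradicalIdeal k C := by
  let r : DualAlgebra k C →ₐ[k] D := e.toAlgHom.comp (dualMap (coradicalInclusion k C))
  have hker : ∀ a, r a = 0 ↔ a ∈ coradicalIdeal k C := fun a => map_eq_zero_iff e e.injective
  obtain ⟨s, hs⟩ := hD.exists_section (isCompleteFiltration_dualFiltration hexh)
    (e.surjective.comp (dualMap_surjective (Submodule.subtype_injective _)))
    (fun a => by rw [dualFiltration_one, ← hker])
  refine ⟨s, fun a => ⟨r a, ?_⟩⟩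
  rw [← hker, map_sub, hs, sub_self]

variable [DivisionRing D] [Algebra k D] [FiniteDimensional k D]

theorem IsChainCoalgebraOfType.exists_injective_coalgHom (hC : IsChainCoalgebraOfType k C D)
    (hD : IsSeparableAlgebra k D) :
    ∃ (τ : D →ₐ[k] D)
      (φ : C →ₗc[k] CotensorCoalgebra k (Dual k D) (Dual k (TwistedBimodule τ))),
      Function.Injective φ := by
  obtain ⟨hC, ⟨e⟩⟩ := hC
  have := e.toEquiv.nontrivial
  have h0 : coradical k C ≠ ⊥ := coradical_ne_bot
  have hexh := hC.exists_mem_coradicalFiltration h0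
  obtain ⟨s, hs⟩ := hD.exists_coradical_section hexh e
  obtain ⟨τ, m, hmI, hm, hgen⟩ := hC.exists_generator h0 hD hs
  have h := isBicolinearAlong_transpose_mulLeft hm
  have hfin := h.isLocallyFinite_homogeneousLift (fun c hc => LinearMap.ext fun x => by
    rw [coradicalFiltration_one] at hc
    exact mem_coradicalIdeal.1 (Ideal.mul_mem_right _ _ hmI) c hc) hexh
  refine ⟨τ, h.lift hfin, coalgHom_injective_of_dense hexh fun a => ?_⟩
  obtain ⟨d, hd⟩ := hs a
  obtain ⟨d', hd'⟩ := hgen _ hd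
  let b₀ := Dual.eval k D d ∘ₗ (projC k (Dual k D) (Dual k (TwistedBimodule τ))).toLinearMap
  let b₁ := Dual.eval k (TwistedBimodule τ) ((TwistedBimodule.equiv τ).symm d') ∘ₗ
    projPow k (Dual k D) (Dual k (TwistedBimodule τ)) 0
  have hb₀ : dualMap (h.lift hfin) (toConv b₀) = s d := WithConv.ext <| LinearMap.ext fun c =>
    LinearMap.congr_fun (h.projC_lift hfin c) d
  have hb₁ : dualMap (h.lift hfin) (toConv b₁) = m * s d' := WithConv.ext <| LinearMap.ext fun c =>
    LinearMap.congr_fun (h.projPow_lift hfin 0 c) ((TwistedBimodule.equiv τ).symm d')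
  exact ⟨toConv b₀ + toConv b₁, by rwa [map_add, hb₀, hb₁, ← sub_sub]⟩

end Embedding

/-! ### Right coideals of the cotensor coalgebra -/

section UniserialFiltration

variable {k C : Type*} [Field k] [AddCommGroup C] [Module k C] [Coalgebra k C]

/-- An exhaustive filtration of a coalgebra for which the right coideal generated by an element is
determined by the degree of the element. -/
structure IsUniserialFiltration (F : ℕ → Submodule k C) : Prop where
  zero : F 0 = ⊥
  mono : Monotone F
  exists_mem : ∀ c, ∃ n, c ∈ F n
  le_of_mem : ∀ {N : Submodule k C}, IsRightCoideal N → ∀ {n : ℕ} {c : C}, c ∈ N →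
    c ∈ F (n + 1) → c ∉ F n → F (n + 1) ≤ N

namespace IsUniserialFiltration

variable {F : ℕ → Submodule k C} (hF : IsUniserialFiltration F)
include hF

theorem exists_degree {c : C} (hc : c ≠ 0) : ∃ n, c ∈ F (n + 1) ∧ c ∉ F n := by
  classical
  obtain ⟨n, hn⟩ := Nat.exists_eq_succ_of_ne_zero (n := Nat.find (hF.exists_mem c)) fun h => by
    have h0 := Nat.find_spec (hF.exists_mem c)
    rw [h, hF.zero, Submodule.mem_bot] at h0
    exact hc h0
  refine ⟨n, ?_, Nat.find_min (hF.exists_mem c) (by omega)⟩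
  rw [← Nat.succ_eq_add_one, ← hn]
  exact Nat.find_spec (hF.exists_mem c)

theorem isChainCoalgebra : IsChainCoalgebra k C := by
  refine fun N N' hN hN' => or_iff_not_imp_left.2 fun hle y hy => ?_
  obtain ⟨x, hx, hxN'⟩ := SetLike.not_le_iff_exists.1 hle
  by_cases hy0 : y = 0
  · exact hy0 ▸ zero_mem N
  obtain ⟨m, hxm, hxm'⟩ := hF.exists_degree (c := x) fun hx0 => hxN' (hx0 ▸ zero_mem N')
  obtain ⟨n, hyn, hyn'⟩ := hF.exists_degree hy0
  have hnm : n ≤ m := by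
    by_contra! hlt
    exact hxN' (hF.le_of_mem hN' hy hyn hyn' (hF.mono (by omega) hxm))
  exact hF.le_of_mem hN hx hxm hxm' (hF.mono (by omega) hyn)

theorem coradical_eq (h1 : IsRightCoideal (F 1)) (h1' : F 1 ≠ ⊥) : coradical k C = F 1 :=
  coradical_eq_of_forall_le h1 h1' fun N hN hN0 => by
    obtain ⟨x, hx, hx0⟩ := Submodule.exists_mem_ne_zero_of_ne_bot hN0
    obtain ⟨n, hn, hn'⟩ := hF.exists_degree hx0
    exact (hF.mono (by omega)).trans (hF.le_of_mem hN hx hn hn')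

end IsUniserialFiltration

end UniserialFiltration

namespace CotensorCoalgebra

section Degree

variable {k C M : Type*} [Field k] [AddCommGroup C] [Module k C] [Coalgebra k C]
  [AddCommGroup M] [Module k M] [Bicomodule k C M]

theorem leftHit_ofC (f : DualAlgebra k (CotensorCoalgebra k C M)) (c : C) :
    leftHit f (ofC k C M c) = ofC k C M (leftHit (toConv (f.ofConv ∘ₗ ofC k C M)) c) := by
  rw [leftHit, comp_apply, comul_ofC, rightSlice_map]
  rfl

theorem leftHit_ofPow (f : DualAlgebra k (CotensorCoalgebra k C M)) (n : ℕ)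
    (x : (cotensorPow k C M n).carrier) :
    leftHit f (ofPow k C M n x) =
      ofC k C M (rightSlice C (f.ofConv ∘ₗ ofPow k C M n) ((cotensorPow k C M n).coact x)) +
      ∑ i ∈ Finset.range (n + 1), ofPow k C M i (rightSlice _ f.ofConv (split k C M n i x)) := by
  simp only [leftHit, comp_apply, comul_ofPow, map_add, map_sum, rightSlice_map, rightSlice_rTensor]

section Split

variable {V : Type*} [AddCommGroup V] [Module k V] {f : CotensorCoalgebra k C M →ₗ[k] V}

theorem lTensor_split_succ_succ_eq_zero {n i : ℕ} (h : ∀ x, f.lTensor _ (split k C M n i x) = 0)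
    (x : (cotensorPow k C M (n + 1)).carrier) :
    f.lTensor _ (split k C M (n + 1) (i + 1) x) = 0 := by
  have h0 : f.lTensor _ ∘ₗ split k C M n i = 0 := LinearMap.ext h
  have hx := split_aux_map (split k C M n i) (split_colinear n i) f x
  rw [h0, lTensor_zero, LinearMap.zero_apply] at hx
  apply split_aux_injective (cotensorPow k C M i)
  exact hx.trans (map_zero ((TensorProduct.assoc k M _ _).toLinearMap ∘ₗ
    (cotensor M (cotensorPow k C M i)).subtype.rTensor V)).symm

theorem lTensor_split_self (hf : f ∘ₗ ofC k C M = 0) :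
    ∀ (n : ℕ) (x : (cotensorPow k C M n).carrier), f.lTensor _ (split k C M n n x) = 0
  | 0, x => by
    have h : f.lTensor M ((ofC k C M).lTensor M (coactR (x : M))) = 0 := by
      rw [← lTensor_comp_apply, hf, lTensor_zero, LinearMap.zero_apply]
    exact h
  | n + 1, x => lTensor_split_succ_succ_eq_zero (lTensor_split_self hf n) x

theorem lTensor_split_of_lt (hf : ∀ n, f ∘ₗ ofPow k C M n = 0) :
    ∀ (n i : ℕ) (_ : i < n) (x : (cotensorPow k C M n).carrier),
      f.lTensor _ (split k C M n i x) = 0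
  | n + 1, 0, _, x => by
    have h : f.lTensor M ((ofPow k C M n).lTensor M x.1) = 0 := by
      rw [← lTensor_comp_apply, hf, lTensor_zero, LinearMap.zero_apply]
    exact h
  | n + 1, i + 1, h, x =>
    lTensor_split_succ_succ_eq_zero (lTensor_split_of_lt hf n i (Nat.lt_of_succ_lt_succ h)) x

theorem lTensor_split_succ_injective (hf : Function.Injective (f ∘ₗ ofPow k C M 0)) :
    ∀ n : ℕ, Function.Injective (f.lTensor _ ∘ₗ split k C M (n + 1) n)
  | 0 => by
    have h : Function.Injective ((f ∘ₗ ofPow k C M 0).lTensor M ∘ₗ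
        (cotensor M (cotensorPow k C M 0)).subtype) :=
      (Module.Flat.lTensor_preserves_injective_linearMap _ hf).comp
        (Submodule.injective_subtype _)
    rwa [lTensor_comp] at h
  | n + 1 => fun x y hxy => by
    have h := split_aux_map (M := M) (split k C M (n + 1) n) (split_colinear (n + 1) n) f
    have hinj := Module.Flat.lTensor_preserves_injective_linearMap (M := M) _
      (lTensor_split_succ_injective hf n)
    refine Subtype.ext (hinj ((h x).symm.trans (Eq.trans ?_ (h y))))
    exact congrArg (fun z => TensorProduct.assoc k M _ _
      ((cotensor M (cotensorPow k C M n)).subtype.rTensor V z)) hxy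

end Split

theorem rightSlice_split_self {f : CotensorCoalgebra k C M →ₗ[k] k} (hf : f ∘ₗ ofC k C M = 0)
    (n : ℕ) (x : (cotensorPow k C M n).carrier) :
    rightSlice _ f (split k C M n n x) = 0 :=
  (congrArg (TensorProduct.rid k _) (lTensor_split_self hf n x)).trans (map_zero _)

variable (k C M) in
/-- The homogeneous components of the cotensor coalgebra; `C` has degree `0`. -/
def homogeneousPart : ℕ → Submodule k (CotensorCoalgebra k C M)
  | 0 => range (ofC k C M)
  | n + 1 => range (ofPow k C M n)

variable (k C M) in
/-- The filtration of the cotensor coalgebra by degree, indexed so that the `n`-th term is the sum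
of the components of degree less than `n`. -/
def degreeFiltration : ℕ → Submodule k (CotensorCoalgebra k C M)
  | 0 => ⊥
  | n + 1 => degreeFiltration n ⊔ homogeneousPart k C M n

theorem degreeFiltration_one : degreeFiltration k C M 1 = range (ofC k C M) := bot_sup_eq _

theorem degreeFiltration_mono : Monotone (degreeFiltration k C M) :=
  monotone_nat_of_le_succ fun _ => le_sup_left

theorem ofC_mem_degreeFiltration {n : ℕ} (hn : 0 < n) (c : C) :
    ofC k C M c ∈ degreeFiltration k C M n :=
  degreeFiltration_mono (Nat.succ_le_of_lt hn) (Submodule.mem_sup_right ⟨c, rfl⟩)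

theorem ofPow_mem_degreeFiltration {m n : ℕ} (h : m + 1 < n) (x : (cotensorPow k C M m).carrier) :
    ofPow k C M m x ∈ degreeFiltration k C M n :=
  degreeFiltration_mono (Nat.succ_le_of_lt h)
    (Submodule.mem_sup_right ⟨x, rfl⟩)

theorem degreeFiltration_succ_le {n : ℕ} {N : Submodule k (CotensorCoalgebra k C M)}
    (h0 : ∀ c, ofC k C M c ∈ N) (h : ∀ i < n, ∀ x, ofPow k C M i x ∈ N) :
    degreeFiltration k C M (n + 1) ≤ N := by
  induction n with
  | zero =>
    rw [degreeFiltration_one]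
    rintro _ ⟨c, rfl⟩
    exact h0 c
  | succ n ih =>
    refine sup_le (ih fun i hi => h i (by omega)) ?_
    rintro _ ⟨x, rfl⟩
    exact h n (by omega) x

theorem exists_mem_degreeFiltration (x : CotensorCoalgebra k C M) :
    ∃ n, x ∈ degreeFiltration k C M n := by
  have hmk : (⨆ n, degreeFiltration k C M n).mkQ = 0 := hom_ext
    (fun c => (Submodule.Quotient.mk_eq_zero _).2
      (Submodule.mem_iSup_of_mem 1 (ofC_mem_degreeFiltration one_pos c)))
    (fun n x => (Submodule.Quotient.mk_eq_zero _).2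
      (Submodule.mem_iSup_of_mem (n + 2) (ofPow_mem_degreeFiltration (by omega) x)))
  have hx : x ∈ ⨆ n, degreeFiltration k C M n :=
    (Submodule.Quotient.mk_eq_zero _).1 (LinearMap.congr_fun hmk x)
  rwa [Submodule.mem_iSup_of_directed _ degreeFiltration_mono.directed_le] at hx

theorem projPow_eq_zero_of_mem {n : ℕ} {x : CotensorCoalgebra k C M}
    (hx : x ∈ degreeFiltration k C M (n + 1)) : projPow k C M n x = 0 := by
  have hle : degreeFiltration k C M (n + 1) ≤ ker (projPow k C M n) :=
    degreeFiltration_succ_le (projPow_ofC n) fun i hi x => projPow_ofPow_of_ne hi.ne x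
  exact hle hx

theorem isRightCoideal_range_ofC : IsRightCoideal (range (ofC k C M)) := by
  rw [isRightCoideal_iff]
  rintro _ ⟨c, rfl⟩ g
  rw [leftHit_ofC]
  exact ⟨_, rfl⟩

theorem leftHit_mem_degreeFiltration {f : DualAlgebra k (CotensorCoalgebra k C M)}
    (hf : f.ofConv ∘ₗ ofC k C M = 0) {n : ℕ} {x : CotensorCoalgebra k C M}
    (hx : x ∈ degreeFiltration k C M (n + 1)) : leftHit f x ∈ degreeFiltration k C M n := by
  have hle : degreeFiltration k C M (n + 1) ≤ (degreeFiltration k C M n).comap (leftHit f) := by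
    refine degreeFiltration_succ_le (fun c => ?_) fun i hi x => ?_
    · rw [Submodule.mem_comap, leftHit_ofC, hf]
      simp [leftHit, rightSlice]
    · rw [Submodule.mem_comap, leftHit_ofPow, Finset.sum_range_succ, rightSlice_split_self hf,
        map_zero, add_zero]
      refine add_mem (ofC_mem_degreeFiltration (by omega) _) (sum_mem fun j hj => ?_)
      exact ofPow_mem_degreeFiltration (by have := Finset.mem_range.1 hj; omega) _
  exact hle hx

end Degree

end CotensorCoalgebra

theorem LeftComod.coact_injective {k C : Type*} [Field k] [AddCommGroup C] [Module k C]
    [Coalgebra k C] (X : LeftComod k C) : Function.Injective X.coact := fun x y h => by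
  have hxy := (X.counit x).symm.trans ((congrArg _ h).trans (X.counit y))
  simpa using congrArg (TensorProduct.lid k X.carrier) hxy

theorem IsRightCoideal.le_of_finrank_le {k C D : Type*} [Field k] [AddCommGroup C] [Module k C]
    [Coalgebra k C] [DivisionRing D] [Algebra k D] {N S : Submodule k C} (hN : IsRightCoideal N)
    (ρ : D →ₐ[k] DualAlgebra k C) [FiniteDimensional k S] (hS : finrank k S ≤ finrank k D)
    (hρ : ∀ d, ∀ x ∈ S, leftHit (ρ d) x ∈ S) {x : C} (hxS : x ∈ S) (hxN : x ∈ N) (hx : x ≠ 0) :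
    S ≤ N := by
  have hinj : Function.Injective (leftOrbit x ∘ₗ ρ.toLinearMap) := by
    refine (injective_iff_map_eq_zero _).2 fun d (hd : leftHit (ρ d) x = 0) => ?_
    by_contra hd0
    have h := leftHit_mul (ρ d⁻¹) (ρ d) x
    rw [← map_mul, inv_mul_cancel₀ hd0, map_one, leftHit_one, hd, map_zero] at h
    exact hx h
  have hle : range (leftOrbit x ∘ₗ ρ.toLinearMap) ≤ S := by
    rintro _ ⟨d, rfl⟩
    exact hρ d x hxS
  rw [← Submodule.eq_of_le_of_finrank_le hle (by rwa [finrank_range_of_inj hinj])]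
  rintro _ ⟨d, rfl⟩
  exact isRightCoideal_iff.1 hN x hxN _

namespace CotensorCoalgebra

section DegreeFiltration

variable {k C M : Type*} [Field k] [AddCommGroup C] [Module k C] [Coalgebra k C]
  [AddCommGroup M] [Module k M] [Bicomodule k C M]

theorem comp_projPow_comp_ofC (n : ℕ) (h : (cotensorPow k C M n).carrier →ₗ[k] k) :
    (h ∘ₗ projPow k C M n) ∘ₗ ofC k C M = 0 :=
  LinearMap.ext fun c => by simp

theorem projPow_comp_ofPow (n : ℕ) : projPow k C M n ∘ₗ ofPow k C M n = LinearMap.id :=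
  LinearMap.ext (projPow_ofPow_self n)

theorem leftHit_projPow_zero_ofPow_zero (h : (cotensorPow k C M 0).carrier →ₗ[k] k)
    (y : (cotensorPow k C M 0).carrier) :
    leftHit (toConv (h ∘ₗ projPow k C M 0)) (ofPow k C M 0 y) =
      ofC k C M (rightSlice C h ((cotensorPow k C M 0).coact y)) := by
  rw [leftHit_ofPow, zero_add, Finset.sum_range_one,
    rightSlice_split_self (comp_projPow_comp_ofC 0 h), map_zero, add_zero, ofConv_toConv,
    LinearMap.comp_assoc, projPow_comp_ofPow, LinearMap.comp_id]

theorem projPow_leftHit_projPow_zero_ofPow_succ (h : (cotensorPow k C M 0).carrier →ₗ[k] k)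
    (n : ℕ) (y : (cotensorPow k C M (n + 1)).carrier) :
    projPow k C M n (leftHit (toConv (h ∘ₗ projPow k C M 0)) (ofPow k C M (n + 1) y)) =
      rightSlice _ h ((projPow k C M 0).lTensor _ (split k C M (n + 1) n y)) := by
  rw [leftHit_ofPow, Finset.sum_range_succ, rightSlice_split_self (comp_projPow_comp_ofC 0 h),
    map_zero, add_zero, Finset.sum_range_succ, map_add, map_add, map_sum, projPow_ofC, zero_add,
    Finset.sum_eq_zero fun i hi => projPow_ofPow_of_ne (Finset.mem_range.1 hi).ne _, zero_add,
    projPow_ofPow_self, ofConv_toConv, rightSlice_comp]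

theorem exists_leftHit_ofPow_notMem {n : ℕ} {y : (cotensorPow k C M n).carrier} (hy : y ≠ 0) :
    ∃ h, leftHit (toConv (h ∘ₗ projPow k C M 0)) (ofPow k C M n y) ∉
      degreeFiltration k C M n := by
  by_contra! hmem
  apply hy
  rcases n with _ | n
  · refine (map_eq_zero_iff _ (LeftComod.coact_injective _)).1
      (eq_zero_of_forall_rightSlice fun h => ?_)
    have h0 : leftHit (toConv (h ∘ₗ projPow k C M 0)) (ofPow k C M 0 y) = 0 := hmem h
    rwa [leftHit_projPow_zero_ofPow_zero, map_eq_zero_iff _ ofC_injective] at h0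
  · have hinj : Function.Injective (projPow k C M 0 ∘ₗ ofPow k C M 0) := by
      rw [projPow_comp_ofPow]
      exact Function.injective_id
    refine (map_eq_zero_iff _ (lTensor_split_succ_injective hinj n)).1
      (eq_zero_of_forall_rightSlice fun h => ?_)
    exact (projPow_leftHit_projPow_zero_ofPow_succ h n y).symm.trans
      (projPow_eq_zero_of_mem (hmem h))

theorem exists_leftHit_notMem {n : ℕ} {x : CotensorCoalgebra k C M}
    (hx : x ∈ degreeFiltration k C M (n + 2)) (hx' : x ∉ degreeFiltration k C M (n + 1)) :
    ∃ f : DualAlgebra k (CotensorCoalgebra k C M),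
      leftHit f x ∈ degreeFiltration k C M (n + 1) ∧ leftHit f x ∉ degreeFiltration k C M n := by
  obtain ⟨z, hz, _, ⟨y, rfl⟩, rfl⟩ := Submodule.mem_sup.1 hx
  have hy : y ≠ 0 := by
    rintro rfl
    rw [map_zero, add_zero] at hx'
    exact hx' hz
  obtain ⟨h, hh⟩ := exists_leftHit_ofPow_notMem hy
  have hC := comp_projPow_comp_ofC (M := M) 0 h
  refine ⟨toConv (h ∘ₗ projPow k C M 0), leftHit_mem_degreeFiltration hC hx, ?_⟩
  have hz' : leftHit (toConv (h ∘ₗ projPow k C M 0)) z ∈ degreeFiltration k C M n :=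
    leftHit_mem_degreeFiltration hC hz
  rwa [map_add, Submodule.add_mem_iff_right _ hz']

theorem leftHit_dualMap_projC_mem_homogeneousPart (a : DualAlgebra k C) {n : ℕ}
    {x : CotensorCoalgebra k C M} (hx : x ∈ homogeneousPart k C M n) :
    leftHit (dualMap (projC k C M) a) x ∈ homogeneousPart k C M n := by
  rcases n with _ | n
  · exact isRightCoideal_iff.1 isRightCoideal_range_ofC x hx _
  · obtain ⟨y, rfl⟩ := hx
    have hf : ∀ i, (dualMap (projC k C M) a).ofConv ∘ₗ ofPow k C M i = 0 := fun i =>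
      LinearMap.ext fun z => (congrArg a (projC_ofPow i z)).trans (map_zero a.ofConv)
    have hsplit : ∀ i < n,
        rightSlice _ (dualMap (projC k C M) a).ofConv (split k C M n i y) = 0 := fun i hi =>
      (congrArg (TensorProduct.rid k _) (lTensor_split_of_lt hf n i hi y)).trans (map_zero _)
    rw [leftHit_ofPow, hf, Finset.sum_range_succ, Finset.sum_eq_zero fun i hi => by
      rw [hsplit i (Finset.mem_range.1 hi), map_zero]]
    simp [rightSlice, homogeneousPart]

theorem bijective_projC_comp_coradicalInclusion
    (h : coradical k (CotensorCoalgebra k C M) = range (ofC k C M)) :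
    Function.Bijective ((projC k C M).comp (coradicalInclusion k (CotensorCoalgebra k C M))) := by
  refine ⟨fun x y hxy => Subtype.ext ?_, fun c => ⟨⟨ofC k C M c, h.ge ⟨c, rfl⟩⟩, projC_ofC c⟩⟩
  obtain ⟨c, hc⟩ := h.le x.2
  obtain ⟨d, hd⟩ := h.le y.2
  have hcd : projC k C M x = projC k C M y := hxy
  rw [← hc, ← hd, projC_ofC, projC_ofC] at hcd
  rw [← hc, ← hd, hcd]

section Uniserial

variable {D : Type*} [DivisionRing D] [Algebra k D]
  [∀ n, FiniteDimensional k (homogeneousPart k C M n)]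
  (hD : ∀ n, finrank k (homogeneousPart k C M n) ≤ finrank k D)
include hD

theorem degreeFiltration_succ_le_of_mem (ρ : D →ₐ[k] DualAlgebra k C)
    {N : Submodule k (CotensorCoalgebra k C M)} (hN : IsRightCoideal N) {n : ℕ}
    (hle : degreeFiltration k C M n ≤ N) {x : CotensorCoalgebra k C M} (hxN : x ∈ N)
    (hx : x ∈ degreeFiltration k C M (n + 1)) (hx' : x ∉ degreeFiltration k C M n) :
    degreeFiltration k C M (n + 1) ≤ N := by
  obtain ⟨z, hz, p, hp, rfl⟩ := Submodule.mem_sup.1 hx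
  rw [Submodule.add_mem_iff_right _ (hle hz)] at hxN
  refine sup_le hle (hN.le_of_finrank_le ((dualMap (projC k C M)).comp ρ) (hD n)
    (fun d y hy => leftHit_dualMap_projC_mem_homogeneousPart (ρ d) hy) hp hxN ?_)
  rintro rfl
  rw [add_zero] at hx'
  exact hx' hz

theorem isUniserialFiltration_degreeFiltration (ρ : D →ₐ[k] DualAlgebra k C) :
    IsUniserialFiltration (degreeFiltration k C M) where
  zero := rfl
  mono := degreeFiltration_mono
  exists_mem := exists_mem_degreeFiltration
  le_of_mem {N} hN n x hxN hx hx' := by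
    induction n generalizing x with
    | zero => exact degreeFiltration_succ_le_of_mem hD ρ hN bot_le hxN hx hx'
    | succ n ih =>
      obtain ⟨f, hf, hf'⟩ := exists_leftHit_notMem hx hx'
      exact degreeFiltration_succ_le_of_mem hD ρ hN
        (ih _ (isRightCoideal_iff.1 hN x hxN f) hf hf') hxN hx hx'

end Uniserial

end DegreeFiltration

end CotensorCoalgebra

section Contraction

theorem leftSlice_leftSlice_assoc {k P E X : Type*} [CommSemiring k] [AddCommMonoid P] [Module k P]
    [AddCommMonoid E] [Module k E] [AddCommMonoid X] [Module k X] (g : P →ₗ[k] k) (ε : E →ₗ[k] k)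
    (w : (P ⊗[k] E) ⊗[k] X) :
    leftSlice X ε (leftSlice (E ⊗[k] X) g (TensorProduct.assoc k P E X w)) =
      leftSlice X (g ∘ₗ rightSlice P ε) w := by
  suffices h : leftSlice X ε ∘ₗ leftSlice (E ⊗[k] X) g ∘ₗ
      (TensorProduct.assoc k P E X).toLinearMap = leftSlice X (g ∘ₗ rightSlice P ε) from
    LinearMap.congr_fun h w
  ext p e x
  simp [smul_smul, mul_comm]

variable {k E P : Type*} [Field k] [AddCommGroup E] [Module k E] [Coalgebra k E]
  [AddCommGroup P] [Module k P] [Bicomodule k E P]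

theorem leftSlice_comp_rightSlice_coactR {X : LeftComod k E} (z : cotensor P X) (g : P →ₗ[k] k)
    (ε : E →ₗ[k] k) :
    leftSlice X.carrier (g ∘ₗ rightSlice P ε ∘ₗ coactR) z =
      leftSlice X.carrier ε (X.coact (leftSlice X.carrier g z)) := by
  have hz : X.coact.lTensor P (z : P ⊗[k] X.carrier) = TensorProduct.assoc k P E X.carrier
    ((coactR : P →ₗ[k] P ⊗[k] E).rTensor X.carrier z) := z.2
  rw [← leftSlice_lTensor, hz, leftSlice_leftSlice_assoc]
  exact (leftSlice_map (g ∘ₗ rightSlice P ε) coactR LinearMap.id _).symm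

theorem leftSlice_cotensor_injective {g : P →ₗ[k] k}
    (hg : ∀ g' : P →ₗ[k] k, ∃ ε : E →ₗ[k] k, g' = g ∘ₗ rightSlice P ε ∘ₗ coactR)
    (X : LeftComod k E) :
    Function.Injective (leftSlice X.carrier g ∘ₗ (cotensor P X).subtype) := by
  refine (injective_iff_map_eq_zero _).2 fun z (hz : leftSlice X.carrier g z = 0) =>
    Subtype.ext (eq_zero_of_forall_leftSlice fun g' => ?_)
  obtain ⟨ε, rfl⟩ := hg g'
  rw [leftSlice_comp_rightSlice_coactR, hz, map_zero, map_zero]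

end Contraction

section DualOfAlgebra

variable {k A B L : Type*} [Field k] [AddCommGroup A] [Module k A] [AddCommGroup B] [Module k B]
  [AddCommGroup L] [Module k L]

theorem rightSlice_eval (b : B) (z : Dual k A ⊗[k] Dual k B) (a : A) :
    rightSlice (Dual k A) (Dual.eval k B b) z a = dualDistrib k A B z (a ⊗ₜ b) := by
  induction z with
  | zero => simp
  | add x y hx hy => simp only [map_add, LinearMap.add_apply, hx, hy]
  | tmul x y => simp [mul_comm]

theorem rightSlice_eval_codual [FiniteDimensional k A] [FiniteDimensional k B]
    (μ : A ⊗[k] B →ₗ[k] L) (f : Dual k L) (a : A) (b : B) :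
    rightSlice (Dual k A) (Dual.eval k B b) (codual μ f) a = f (μ (a ⊗ₜ b)) := by
  rw [rightSlice_eval, dualDistrib_codual, comp_apply]

variable (k) in
/-- A finite-dimensional algebra is isomorphic to the algebra dual to its dual coalgebra. -/
def evalAlgEquiv (A : Type*) [Ring A] [Algebra k A] [FiniteDimensional k A] :
    A ≃ₐ[k] DualAlgebra k (Dual k A) :=
  AlgEquiv.ofLinearEquiv ((evalEquiv k A).trans (WithConv.linearEquiv k _).symm) rfl
    fun a b => WithConv.ext (LinearMap.ext fun f =>
      ((mul_apply_leftHit _ _ f).trans (rightSlice_eval_codual (mul' k A) f a b)).symm)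

end DualOfAlgebra

theorem exists_op_smul_eq {k D M : Type*} [Field k] [DivisionRing D] [Algebra k D]
    [FiniteDimensional k D] [AddCommGroup M] [Module k M] [Module Dᵐᵒᵖ M] [IsScalarTower k Dᵐᵒᵖ M]
    (h : finrank k M = finrank k D) [FiniteDimensional k M] {m : M} (hm : m ≠ 0) (x : M) :
    ∃ d : D, MulOpposite.op d • m = x := by
  let orbit : D →ₗ[k] M := rightAct k D M ∘ₗ TensorProduct.mk k M D m
  have horbit : Function.Injective orbit := by
    refine (injective_iff_map_eq_zero _).2 fun d (hd : MulOpposite.op d • m = 0) => ?_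
    exact (MulOpposite.op_eq_zero_iff d).1 ((smul_eq_zero.1 hd).resolve_right hm)
  exact (injective_iff_surjective_of_finrank_eq_finrank h.symm).1 horbit x

namespace CotensorCoalgebra

section DualBimodule

variable {k D M : Type*} [Field k] [DivisionRing D] [Algebra k D] [FiniteDimensional k D]
  [AddCommGroup M] [Module k M] [Module D M] [Module Dᵐᵒᵖ M] [IsScalarTower k D M]
  [IsScalarTower k Dᵐᵒᵖ M] [SMulCommClass D Dᵐᵒᵖ M] [FiniteDimensional k M] (e : M ≃ₗ[k] D)
include e

theorem leftSlice_eval_cotensor_injective {m : M} (hm : m ≠ 0) (X : LeftComod k (Dual k D)) :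
    Function.Injective (leftSlice X.carrier (Dual.eval k M m) ∘ₗ
      (cotensor (Dual k M) X).subtype) := by
  refine leftSlice_cotensor_injective (fun g' => ?_) X
  obtain ⟨x, rfl⟩ := (evalEquiv k M).surjective g'
  obtain ⟨d, rfl⟩ := exists_op_smul_eq e.finrank_eq hm x
  exact ⟨Dual.eval k D d, LinearMap.ext fun p =>
    (rightSlice_eval_codual (rightAct k D M) p m d).symm⟩

theorem finrank_cotensorPow_le (n : ℕ) :
    FiniteDimensional k (cotensorPow k (Dual k D) (Dual k M) n).carrier ∧
      finrank k (cotensorPow k (Dual k D) (Dual k M) n).carrier ≤ finrank k D := by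
  induction n with
  | zero =>
    exact ⟨inferInstanceAs (FiniteDimensional k (Dual k M)),
      (Subspace.dual_finrank_eq.trans e.finrank_eq).le⟩
  | succ n ih =>
    obtain ⟨_, hn⟩ := ih
    have hinj := leftSlice_eval_cotensor_injective e (m := e.symm 1) (by simp)
      (cotensorPow k (Dual k D) (Dual k M) n)
    exact ⟨FiniteDimensional.of_injective _ hinj, (finrank_le_finrank_of_injective hinj).trans hn⟩

theorem finrank_homogeneousPart_le (n : ℕ) :
    FiniteDimensional k (homogeneousPart k (Dual k D) (Dual k M) n) ∧
      finrank k (homogeneousPart k (Dual k D) (Dual k M) n) ≤ finrank k D := by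
  rcases n with _ | n
  · exact ⟨finiteDimensional_range (ofC k (Dual k D) (Dual k M)),
      (finrank_range_le _).trans Subspace.dual_finrank_eq.le⟩
  · obtain ⟨_, hn⟩ := finrank_cotensorPow_le e n
    exact ⟨finiteDimensional_range (ofPow k (Dual k D) (Dual k M) n),
      (finrank_range_le _).trans hn⟩

theorem isChainCoalgebraOfType :
    IsChainCoalgebraOfType k (CotensorCoalgebra k (Dual k D) (Dual k M)) D := by
  have := fun n => (finrank_homogeneousPart_le e n).1
  have hF := isUniserialFiltration_degreeFiltration
    (fun n => (finrank_homogeneousPart_le e n).2) (evalAlgEquiv k D).toAlgHom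
  have hcorad : coradical k (CotensorCoalgebra k (Dual k D) (Dual k M)) =
      range (ofC k (Dual k D) (Dual k M)) := by
    rw [hF.coradical_eq, degreeFiltration_one]
    · rw [degreeFiltration_one]
      exact isRightCoideal_range_ofC
    · rw [degreeFiltration_one, Ne, range_eq_bot]
      intro h
      obtain ⟨f, hf⟩ := exists_ne (0 : Dual k D)
      exact hf (ofC_injective (LinearMap.congr_fun h f))
  have hproj := bijective_projC_comp_coradicalInclusion hcorad
  exact ⟨hF.isChainCoalgebra, ⟨((evalAlgEquiv k D).trans (AlgEquiv.ofBijective (dualMap _)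
    ⟨dualMap_injective hproj.2, dualMap_surjective hproj.1⟩)).symm⟩⟩

end DualBimodule

end CotensorCoalgebra

end ChainCoalg

end

theorem mainTheorem5 {k : Type u} {D : Type v} [Field k] [DivisionRing D] [Algebra k D]
    [FiniteDimensional k D] :
    (∀ (M : Type w) [AddCommGroup M] [Module k M] [Module D M] [Module Dᵐᵒᵖ M]
      [IsScalarTower k D M] [IsScalarTower k Dᵐᵒᵖ M] [SMulCommClass D Dᵐᵒᵖ M]
      [FiniteDimensional k M], Nonempty (M ≃ₗ[k] D) →
        ChainCoalg.IsChainCoalgebraOfType k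
          (ChainCoalg.CotensorCoalgebra k (Module.Dual k D) (Module.Dual k M)) D) ∧
    (ChainCoalg.IsSeparableAlgebra k D →
      ∀ (C : Type t) [AddCommGroup C] [Module k C] [Coalgebra k C],
        ChainCoalg.IsChainCoalgebraOfType k C D →
        ∃ (M : Type v) (_ : AddCommGroup M) (_ : Module k M) (_ : Module D M) (_ : Module Dᵐᵒᵖ M)
          (_ : IsScalarTower k D M) (_ : IsScalarTower k Dᵐᵒᵖ M) (_ : SMulCommClass D Dᵐᵒᵖ M)
          (_ : FiniteDimensional k M),
          Nonempty (M ≃ₗ[k] D) ∧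
          ∃ φ : C →ₗc[k] ChainCoalg.CotensorCoalgebra k (Module.Dual k D) (Module.Dual k M),
            Function.Injective φ) := by
  refine ⟨fun M _ _ _ _ _ _ _ _ ⟨e⟩ => ChainCoalg.CotensorCoalgebra.isChainCoalgebraOfType e,
    fun hD C _ _ _ hC => ?_⟩
  obtain ⟨τ, φ, hφ⟩ := hC.exists_injective_coalgHom hD
  exact ⟨ChainCoalg.TwistedBimodule τ, inferInstance, inferInstance, inferInstance, inferInstance,
    inferInstance, inferInstance, inferInstance, inferInstance,
    ⟨ChainCoalg.TwistedBimodule.equiv τ⟩, φ, hφ⟩
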